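/- Let $\theta=(\theta_0,\theta_1,\theta_2)\in\mathbb R^3$ with $\theta_2>0$, let $\sigma\in\mathbb R$ be a constant volatility, and put, for $k\ge1$, $$e_k(y)=\sqrt2\,\sin(\pi k y)\,e^{-\frac{\theta_1}{2\theta_2}y},\qquad \lambda_k=-\theta_0+\frac{\theta_1^2}{4\theta_2}+\pi^2k^2\theta_2,\qquad \langle f,g\rangle_\theta=\int_0^1e^{y\theta_1/\theta_2}f(y)g(y)\,dy .$$ Assume $\lambda_1>0$ (so that all $\lambda_k>0$ and the stationary distribution exists). Let $X=(X_t(y))_{t,y\in[0,1]}$ be the mild solution, continuous in $(t,y)$, of the SPDE $dX_t=(\theta_0+\theta_1\partial_y+\theta_2\partial_y^2)X_t\,dt+\sigma\,dB_t$ on $[0,1]$ with $X_t(0)=X_t(1)=0$, i.e. $$\langle X_t,e_k\rangle_\theta=e^{-\lambda_kt}\langle X_0,e_k\rangle_\theta+\int_0^te^{-\lambda_k(t-s)}\sigma\,dW^k_s\quad\text{a.s.},\qquad k\ge1,\ t\in[0,1],$$ with independent Brownian motions $(W^k)_{k\ge1}$, under the stationary initial condition: the coefficients $\langle X_0,e_k\rangle_\theta\sim\mathcal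 N(0,\sigma^2/(2\lambda_k))$, $k\ge1$, are independent, and independent of $(W^k)_{k\ge1}$. For $n\ge1$ let $\Delta_n=1/n$, $\Delta_iX(y)=X_{i\Delta_n}(y)-X_{(i-1)\Delta_n}(y)$, and for $1\le p\le n$ $$V_{p,\Delta_n}(y)=\frac1{p\sqrt{\Delta_n}}\sum_{i=1}^p(\Delta_iX)^2(y)\,e^{y\theta_1/\theta_2}.$$ Let $$\Gamma=\frac1\pi\sum_{r=0}^\infty I(r)^2+\frac2\pi,\qquad I(r)=2\sqrt{r+1}-\sqrt{r+2}-\sqrt r .$$ The series converges, $\Gamma>0$, and $\Gamma\approx0.75$ (that is, $|\Gamma-0.75|<0.005$). The variables $V_{p,\Delta_n}(y)$, $y\in(0,1)$, are square integrable, and the following holds. (i) For every $\eta\in(0,1)$, $$\operatorname{Cov}\big(V_{p,\Delta_n}(y_1),V_{p,\Delta_n}(y_2)\big)=\mathbf 1_{\{y_1=y_2\}}\,p^{-1}\Gamma\sigma^4\theta_2^{-1}\Big(1+\mathcal O\big(1\wedge(p^{-1}\Delta_n^{\eta-1})\big)\Big)+\mathcal O\Big(\frac{\Delta_n^{1/2}}p\big(\mathbf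 1_{\{y_1\ne y_2\}}|y_1-y_2|^{-1}+\delta^{-1}\big)\Big).$$ Here the $\mathcal O$-terms are bounded by a constant $C$ times their argument for all $n\ge n_0$, all $1\le p\le n$, all $\delta>0$ and all $y_1,y_2\in[\delta,1-\delta]$, where $C$ and $n_0$ depend only on $\theta,\sigma,\eta$. (ii) In particular, for every $\delta>0$, uniformly in $y\in[\delta,1-\delta]$, $$\operatorname{Var}\big(V_{n,\Delta_n}(y)\big)=n^{-1}\Gamma\sigma^4\theta_2^{-1}\big(1+\mathcal O(\sqrt{\Delta_n})\big),\qquad n\to\infty .$$ -/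

import Mathlib

open MeasureTheory ProbabilityTheory Set
open scoped NNReal ENNReal

universe u

noncomputable section

namespace SPDE

/-! The SPDE is `dX_t = (θ₀ + θ₁ ∂_y + θ₂ ∂_y²) X_t dt + σ dB_t` on `[0, 1]` with Dirichlet boundary
conditions; the parameter vector is `θ = (θ 0, θ 1, θ 2)`. -/

/-- `λ_k = -θ₀ + θ₁² / (4 θ₂) + π² k² θ₂`; the operator has the eigenvalues `-λ_k`, `k ≥ 1`. -/
def eigenvalue (θ : Fin 3 → ℝ) (k : ℕ) : ℝ :=
  -θ 0 + θ 1 ^ 2 / (4 * θ 2) + Real.pi ^ 2 * (k : ℝ) ^ 2 * θ 2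

/-- `e_k(y) = √2 sin(π k y) exp(-θ₁ y / (2 θ₂))`, `k ≥ 1`. -/
def eigenfunction (θ : Fin 3 → ℝ) (k : ℕ) (y : ℝ) : ℝ :=
  Real.sqrt 2 * Real.sin (Real.pi * k * y) * Real.exp (-(θ 1 / (2 * θ 2)) * y)

/-- The weighted scalar product `⟨f, g⟩_θ = ∫₀¹ exp(y θ₁ / θ₂) f(y) g(y) dy`, for which
`(e_k)_{k ≥ 1}` is an orthonormal basis. -/
def innerθ (θ : Fin 3 → ℝ) (f g : ℝ → ℝ) : ℝ :=
  ∫ y in (0 : ℝ)..1, Real.exp (y * θ 1 / θ 2) * f y * g y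

/-- The Wiener integral `∫₀ᵗ f(s) dw(s)` of a deterministic `C¹` integrand `f` against a continuous
path `w`, as a Riemann-Stieltjes integral (evaluated by partial integration). -/
def wienerIntegral (f : ℝ → ℝ) (w : ℝ≥0 → ℝ) (t : ℝ) : ℝ :=
  f t * w t.toNNReal - f 0 * w 0 - ∫ s in (0 : ℝ)..t, deriv f s * w s.toNNReal

/-- The coordinate `x_k(t) = ⟨X_t, e_k⟩_θ` of a random field `X`. -/
def coord {Ω : Type u} (θ : Fin 3 → ℝ) (X : ℝ → ℝ → Ω → ℝ) (k : ℕ) (t : ℝ) (ω : Ω) : ℝ :=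
  innerθ θ (fun y => X t y ω) (eigenfunction θ k)

/-- `X` (with `X t y ω` for `X_t(y)(ω)`) is the (space-time continuous) mild solution on the time
interval `[0, 1]` of the SPDE with constant volatility `σ`, driven by the cylindrical Brownian
motion with coordinate processes `(W k)`, and started in the stationary distribution.
The index `k : ℕ` stands for the mode `k + 1`. -/
structure IsStationarySolution {Ω : Type u} [MeasurableSpace Ω] (P : Measure Ω)
    (θ : Fin 3 → ℝ) (σ : ℝ) (W : ℕ → ℝ≥0 → Ω → ℝ) (X : ℝ → ℝ → Ω → ℝ) : Prop where
  /-- the `W k` are Brownian motions -/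
  brownian : ∀ k, IsBrownianReal (W k) P
  /-- the processes `W k` are mutually independent -/
  indep_brownian : iIndepFun (fun k ω => fun t => W k t ω) P
  /-- the values of `X` are random variables -/
  aemeasurable : ∀ t ∈ Icc (0 : ℝ) 1, ∀ y ∈ Icc (0 : ℝ) 1, AEMeasurable (X t y) P
  /-- `(t, y) ↦ X_t(y)` is almost surely continuous -/
  continuous : ∀ᵐ ω ∂P,
    ContinuousOn (fun q : ℝ × ℝ => X q.1 q.2 ω) (Icc (0 : ℝ) 1 ×ˢ Icc (0 : ℝ) 1)
  /-- Dirichlet boundary conditions -/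
  dirichlet : ∀ᵐ ω ∂P, ∀ t ∈ Icc (0 : ℝ) 1, X t 0 ω = 0 ∧ X t 1 ω = 0
  /-- `⟨ξ, e_k⟩_θ ∼ N(0, σ² / (2 λ_k))` for the initial value `ξ = X_0` -/
  init_law : ∀ k, HasLaw (coord θ X (k + 1) 0)
    (gaussianReal 0 (σ ^ 2 / (2 * eigenvalue θ (k + 1))).toNNReal) P
  /-- the coefficients of the initial value are independent -/
  init_indep : iIndepFun (fun k => coord θ X (k + 1) 0) P
  /-- the initial value is independent of the driving noise -/
  init_indep_noise : IndepFun (fun ω => fun k : ℕ => coord θ X (k + 1) 0 ω)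
    (fun ω => fun (k : ℕ) (t : ℝ≥0) => W k t ω) P
  /-- the mild equation `X_t = e^{tA} ξ + ∫₀ᵗ e^{(t-s)A} σ dB_s`, in the orthonormal basis `(e_k)`
  that diagonalizes the semigroup -/
  mild : ∀ t ∈ Icc (0 : ℝ) 1, ∀ k, ∀ᵐ ω ∂P,
    coord θ X (k + 1) t ω = Real.exp (-eigenvalue θ (k + 1) * t) * coord θ X (k + 1) 0 ω
      + wienerIntegral (fun s => Real.exp (-eigenvalue θ (k + 1) * (t - s)) * σ)
          (fun s => W k s ω) t

/-- The time mesh `Δ_n = 1 / n`. -/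
def mesh (n : ℕ) : ℝ := 1 / n

/-- The increment `Δ_i X(y) = X_{iΔ_n}(y) - X_{(i-1)Δ_n}(y)`. -/
def increment {Ω : Type u} (X : ℝ → ℝ → Ω → ℝ) (n i : ℕ) (y : ℝ) (ω : Ω) : ℝ :=
  X (i * mesh n) y ω - X (((i : ℝ) - 1) * mesh n) y ω

/-- The rescaled realized volatility
`V_{p,Δ_n}(y) = (p √Δ_n)⁻¹ ∑_{i=1}^p (Δ_i X)²(y) exp(y θ₁ / θ₂)`. -/
def realizedVol {Ω : Type u} (θ : Fin 3 → ℝ) (X : ℝ → ℝ → Ω → ℝ) (p n : ℕ) (y : ℝ) (ω : Ω) : ℝ :=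
  1 / (p * Real.sqrt (mesh n)) *
    ∑ i ∈ Finset.Icc 1 p, increment X n i y ω ^ 2 * Real.exp (y * θ 1 / θ 2)

/-- `I(r) = 2 √(r+1) - √(r+2) - √r`. -/
def I (r : ℕ) : ℝ :=
  2 * Real.sqrt ((r : ℝ) + 1) - Real.sqrt ((r : ℝ) + 2) - Real.sqrt (r : ℝ)

/-- `Γ = π⁻¹ ∑_{r ≥ 0} I(r)² + 2 / π`. -/
def gammaConst : ℝ := 1 / Real.pi * ∑' r : ℕ, I r ^ 2 + 2 / Real.pi

end SPDE

end

/-! After multiplication by exp(θ₁y/(2θ₂)) the field has plain sine coefficients, and these are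
independent stationary Ornstein-Uhlenbeck processes. Its increments are therefore jointly centred
Gaussian with covariances σ²Δ · `incrCov`, where `incrCov` is a sum over the modes of products of
sines times a lag function of λ_kΔ. Since Cov(Z², Y²) = 2 Cov(Z, Y)² for Gaussian pairs, the
covariance of the realized volatilities is exactly 2σ⁴Δp⁻² times the double sum of `incrCov`² over
the lags |i - j| (`covariance_realizedVol`). The rest is deterministic analysis.

Gaussianity has to be extracted from the mild equation. Each coordinate is a limit of
Riemann-Stieltjes sums of Brownian increments (`isCentredGaussian_coord_sum`). The value of the
field at a point is the limit of its averages against hat functions, whose sine series converge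
absolutely (`isCentredGaussian_field_sum`). Almost sure limits preserve centred Gaussian laws as
soon as the variances converge.

For the analysis, a product of sines splits into cosines of y - z and y + z. At a nonzero frequency
w, Abel summation bounds the cosine sum by a multiple of 1/|sin(πw/2)| (`abs_cosLag_le`). At w = 0
the sum is a Riemann sum, equal to (πθ₂Δ)^(-1/2) · `lagLim r` + O(1)
(`exists_abs_tsum_lagFun_sub_le`). Both bounds are uniform in the lag r, because `lagMaj` controls
the variation of all lag functions at once. Moreover the absolute covariances, summed over all lags,
are only O(Δ^(-1/2)) (`exists_sum_absLag_le`).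

On the diagonal the squares of the leading terms sum to (pπΓ/2 - O(1))/(πθ₂Δ), which yields Γ/(pθ₂)
with relative error O(1/p) (`double_sum_lagLim`). Every other contribution pairs a factor bounded by
δ⁻¹ or |y - z|⁻¹ + δ⁻¹ with a factor summable over the lags to O(Δ^(-1/2)), which gives the
remainder √Δ/p. -/

noncomputable section

namespace SPDE

open Filter Topology

/-! ### Centred Gaussian random variables -/

/-- `Z` is a centred Gaussian random variable with variance `v`. -/
structure IsCentredGaussian {Ω : Type*} [MeasurableSpace Ω] (P : Measure Ω) (Z : Ω → ℝ)
    (v : ℝ) : Prop where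
  nonneg : 0 ≤ v
  hasLaw : HasLaw Z (gaussianReal 0 v.toNNReal) P

namespace IsCentredGaussian

variable {Ω : Type*} [MeasurableSpace Ω] {P : Measure Ω} {Z Y : Ω → ℝ} {v w : ℝ}

lemma aemeasurable (h : IsCentredGaussian P Z v) : AEMeasurable Z P := h.hasLaw.aemeasurable

lemma congr (h : IsCentredGaussian P Z v) (hY : Y =ᵐ[P] Z) : IsCentredGaussian P Y v :=
  ⟨h.nonneg, h.hasLaw.congr hY⟩

lemma const_mul (h : IsCentredGaussian P Z v) (c : ℝ) :
    IsCentredGaussian P (fun ω => c * Z ω) (c ^ 2 * v) := by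
  refine ⟨mul_nonneg (sq_nonneg c) h.nonneg, ?_⟩
  have := gaussianReal_const_mul h.hasLaw c
  rw [mul_zero] at this
  convert this using 2
  apply NNReal.eq
  rw [Real.coe_toNNReal _ (mul_nonneg (sq_nonneg c) h.nonneg), NNReal.coe_mul,
    Real.coe_toNNReal _ h.nonneg]
  rfl

lemma add_of_indepFun (hZ : IsCentredGaussian P Z v) (hY : IsCentredGaussian P Y w)
    (h : IndepFun Z Y P) : IsCentredGaussian P (fun ω => Z ω + Y ω) (v + w) := by
  refine ⟨add_nonneg hZ.nonneg hY.nonneg, hZ.aemeasurable.add hY.aemeasurable, ?_⟩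
  have := gaussianReal_add_gaussianReal_of_indepFun h hZ.hasLaw.map_eq hY.hasLaw.map_eq
  rw [zero_add, ← Real.toNNReal_add hZ.nonneg hY.nonneg] at this
  exact this

lemma zero [IsProbabilityMeasure P] : IsCentredGaussian P (fun _ => 0) 0 := by
  refine ⟨le_rfl, ?_⟩
  rw [Real.toNNReal_zero, gaussianReal_zero_var]
  exact hasLaw_dirac_of_ae_eq (ae_of_all _ fun _ => rfl)

lemma sum_of_iIndepFun [IsProbabilityMeasure P] {ι : Type*} {Z : ι → Ω → ℝ} {v : ι → ℝ}
    (s : Finset ι) (hZ : ∀ i, IsCentredGaussian P (Z i) (v i)) (h : iIndepFun Z P) :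
    IsCentredGaussian P (fun ω => ∑ i ∈ s, Z i ω) (∑ i ∈ s, v i) := by
  classical
  induction s using Finset.induction_on with
  | empty => simpa using zero
  | insert a s ha ih =>
    simp only [Finset.sum_insert ha]
    refine (hZ a).add_of_indepFun ih ?_
    have := (h.indepFun_finsetSum_of_notMem₀ (fun i => (hZ i).aemeasurable) ha).symm
    convert this using 2
    simp

/-- Almost sure limits of centred Gaussian variables are Gaussian if the variances converge. -/
lemma of_tendsto [IsProbabilityMeasure P] {Z : ℕ → Ω → ℝ} {v : ℕ → ℝ} {Z' : Ω → ℝ} {v' : ℝ}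
    (hZ : ∀ n, IsCentredGaussian P (Z n) (v n))
    (hlim : ∀ᵐ ω ∂P, Tendsto (fun n => Z n ω) atTop (𝓝 (Z' ω)))
    (hv : Tendsto v atTop (𝓝 v')) : IsCentredGaussian P Z' v' := by
  have hv' : 0 ≤ v' := ge_of_tendsto' hv fun n => (hZ n).nonneg
  have hm : AEMeasurable Z' P :=
    aemeasurable_of_tendsto_metrizable_ae _ (fun n => (hZ n).aemeasurable) hlim
  refine ⟨hv', hm, ?_⟩
  have : IsProbabilityMeasure (P.map Z') := Measure.isProbabilityMeasure_map hm
  refine Measure.ext_of_charFun ?_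
  ext t
  -- The characteristic functions converge in two ways: by dominated convergence to that of the
  -- limit, and by the explicit Gaussian formula to that of the law with variance `v'`.
  have h1 : Tendsto (fun n => charFun (P.map (Z n)) t) atTop (𝓝 (charFun (P.map Z') t)) := by
    simp only [charFun_apply_real]
    have e : ∀ {Y : Ω → ℝ}, AEMeasurable Y P → ∫ x, Complex.exp (t * x * Complex.I) ∂(P.map Y)
        = ∫ ω, Complex.exp (t * Y ω * Complex.I) ∂P := fun {Y} hY =>
      integral_map hY (Continuous.aestronglyMeasurable (by fun_prop))
    rw [e hm]
    simp only [fun n => e (hZ n).aemeasurable]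
    refine tendsto_integral_of_dominated_convergence (fun _ => (1 : ℝ)) (fun n => ?_)
      (integrable_const _) (fun n => ?_) ?_
    · have hc : Continuous fun x : ℝ => Complex.exp (t * x * Complex.I) := by fun_prop
      exact (hc.measurable.comp_aemeasurable (hZ n).aemeasurable).aestronglyMeasurable
    · refine ae_of_all _ fun ω => ?_
      rw [← Complex.ofReal_mul, Complex.norm_exp_ofReal_mul_I]
    · filter_upwards [hlim] with ω hω
      have hc : Continuous fun x : ℝ => Complex.exp (t * x * Complex.I) := by fun_prop
      exact (hc.tendsto _).comp hω
  have h2 : Tendsto (fun n => charFun (P.map (Z n)) t) atTop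
      (𝓝 (charFun (gaussianReal 0 v'.toNNReal) t)) := by
    simp only [fun n => (hZ n).hasLaw.map_eq, charFun_gaussianReal]
    have : ∀ n, (((v n).toNNReal : ℝ) : ℂ) = (v n : ℂ) := fun n => by
      rw [Real.coe_toNNReal _ (hZ n).nonneg]
    simp only [this, Real.coe_toNNReal _ hv']
    have hc : Continuous fun x : ℝ => Complex.exp (t * (0 : ℝ) * Complex.I - x * t ^ 2 / 2) := by
      fun_prop
    exact (hc.tendsto _).comp hv
  exact tendsto_nhds_unique h1 h2

lemma memLp (h : IsCentredGaussian P Z v) {p : ℝ≥0∞} (hp : p ≠ ∞) : MemLp Z p P := by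
  have := memLp_id_gaussianReal' (μ := 0) (v := v.toNNReal) p hp
  rw [← h.hasLaw.map_eq] at this
  exact (memLp_map_measure_iff aestronglyMeasurable_id h.aemeasurable).1 this

/-- Moments are the derivatives at 0 of the moment generating function, which is explicit for a
Gaussian law. -/
lemma integral_pow_eq (h : IsCentredGaussian P Z v) (n : ℕ) :
    ∫ ω, Z ω ^ n ∂P = iteratedDeriv n (fun t => Real.exp (v * t ^ 2 / 2)) 0 := by
  have h1 := h.hasLaw.integral_comp (f := fun x : ℝ => x ^ n)
    (Continuous.aestronglyMeasurable (by fun_prop))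
  rw [show (∫ ω, Z ω ^ n ∂P) = ∫ x, x ^ n ∂(gaussianReal 0 v.toNNReal) from h1]
  have h2 := iteratedDeriv_mgf_zero (X := id) (μ := gaussianReal 0 v.toNNReal) (by simp) n
  rw [mgf_id_gaussianReal] at h2
  simp only [Pi.pow_apply, id, zero_mul, zero_add, Real.coe_toNNReal _ h.nonneg] at h2
  exact h2.symm

lemma hasDerivAt_mul_exp {p : ℝ → ℝ} {p' : ℝ} (v t : ℝ) (hp : HasDerivAt p p' t) :
    HasDerivAt (fun t => p t * Real.exp (v * t ^ 2 / 2))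
      ((p' + p t * (v * t)) * Real.exp (v * t ^ 2 / 2)) t := by
  have h1 : HasDerivAt (fun t : ℝ => v * t ^ 2 / 2) (v * t) t := by
    refine (((hasDerivAt_pow 2 t).const_mul v).div_const 2).congr_deriv ?_
    push_cast; ring
  refine (hp.mul h1.exp).congr_deriv ?_
  ring

lemma deriv_exp_sq (v : ℝ) : deriv (fun t => Real.exp (v * t ^ 2 / 2))
    = fun t => v * t * Real.exp (v * t ^ 2 / 2) := by
  ext t
  have := (hasDerivAt_mul_exp v t (hasDerivAt_const t (1 : ℝ))).deriv
  simpa using this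

lemma deriv_deriv_exp_sq (v : ℝ) : deriv (fun t => v * t * Real.exp (v * t ^ 2 / 2))
    = fun t => (v + v ^ 2 * t ^ 2) * Real.exp (v * t ^ 2 / 2) := by
  ext t
  rw [(hasDerivAt_mul_exp v t ((hasDerivAt_id' t).const_mul v)).deriv]
  ring

lemma integral_sq (h : IsCentredGaussian P Z v) : ∫ ω, Z ω ^ 2 ∂P = v := by
  rw [h.integral_pow_eq, iteratedDeriv_succ, iteratedDeriv_one, deriv_exp_sq, deriv_deriv_exp_sq]
  simp

lemma integral_pow_four (h : IsCentredGaussian P Z v) : ∫ ω, Z ω ^ 4 ∂P = 3 * v ^ 2 := by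
  have h3 : deriv (fun t => (v + v ^ 2 * t ^ 2) * Real.exp (v * t ^ 2 / 2))
      = fun t => (3 * v ^ 2 * t + v ^ 3 * t ^ 3) * Real.exp (v * t ^ 2 / 2) := by
    ext t
    rw [(hasDerivAt_mul_exp v t (((hasDerivAt_pow 2 t).const_mul (v ^ 2)).const_add v)).deriv]
    push_cast; ring
  have h4 : deriv (fun t => (3 * v ^ 2 * t + v ^ 3 * t ^ 3) * Real.exp (v * t ^ 2 / 2)) 0
      = 3 * v ^ 2 := by
    have h5 : HasDerivAt (fun t : ℝ => 3 * v ^ 2 * t + v ^ 3 * t ^ 3) (3 * v ^ 2) 0 := by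
      refine (((hasDerivAt_id' (0 : ℝ)).const_mul (3 * v ^ 2)).add
        ((hasDerivAt_pow 3 (0 : ℝ)).const_mul (v ^ 3))).congr_deriv ?_
      norm_num
    rw [(hasDerivAt_mul_exp v 0 h5).deriv]
    simp
  rw [h.integral_pow_eq, iteratedDeriv_succ, iteratedDeriv_succ, iteratedDeriv_succ,
    iteratedDeriv_one, deriv_exp_sq, deriv_deriv_exp_sq, h3, h4]

lemma memLp_sq (h : IsCentredGaussian P Z v) : MemLp (fun ω => Z ω ^ 2) 2 P := by
  have := (h.memLp (p := 4) (by simp)).norm_rpow_div 2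
  have e : (4 : ℝ≥0∞) / 2 = 2 := by
    rw [show (4 : ℝ≥0∞) = 2 * 2 by norm_num, ENNReal.mul_div_cancel_right] <;> simp
  rw [e] at this
  refine this.ae_eq (ae_of_all _ fun ω => ?_)
  simp

/-- The covariance of the squares of two jointly Gaussian variables. -/
lemma covariance_sq [IsProbabilityMeasure P] {c : ℝ} (hZ : IsCentredGaussian P Z v)
    (hY : IsCentredGaussian P Y w)
    (hadd : IsCentredGaussian P (fun ω => Z ω + Y ω) (v + w + 2 * c))
    (hsub : IsCentredGaussian P (fun ω => Z ω - Y ω) (v + w - 2 * c)) :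
    cov[fun ω => Z ω ^ 2, fun ω => Y ω ^ 2; P] = 2 * c ^ 2 := by
  rw [covariance_eq_sub hZ.memLp_sq hY.memLp_sq, hZ.integral_sq, hY.integral_sq]
  have int4 : ∀ {U : Ω → ℝ} {a : ℝ}, IsCentredGaussian P U a → Integrable (fun ω => U ω ^ 4) P :=
    fun {U a} hU => by
      have := (hU.memLp_sq).integrable_sq
      simpa only [← pow_mul] using this
  -- Polarization: 12 Z²Y² = (Z+Y)⁴ + (Z-Y)⁴ - 2Z⁴ - 2Y⁴. Only fourth moments of single Gaussian
  -- variables are then needed, each equal to three times the squared variance.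
  have key : (∫ ω, ((fun ω => Z ω ^ 2) * fun ω => Y ω ^ 2) ω ∂P)
      = (1 / 12) * ((∫ ω, (Z ω + Y ω) ^ 4 ∂P) + (∫ ω, (Z ω - Y ω) ^ 4 ∂P)
        - 2 * (∫ ω, Z ω ^ 4 ∂P) - 2 * ∫ ω, Y ω ^ 4 ∂P) := by
    have i1 := int4 hadd
    have i2 := int4 hsub
    have i3 := (int4 hZ).const_mul 2
    have i4 := (int4 hY).const_mul 2
    have i12 : Integrable (fun ω => (Z ω + Y ω) ^ 4 + (Z ω - Y ω) ^ 4) P := i1.add i2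
    have i123 : Integrable (fun ω => (Z ω + Y ω) ^ 4 + (Z ω - Y ω) ^ 4 - 2 * Z ω ^ 4) P :=
      i12.sub i3
    rw [← integral_const_mul, ← integral_const_mul, ← integral_add i1 i2, ← integral_sub i12 i3,
      ← integral_sub i123 i4, ← integral_const_mul]
    congr 1
    ext ω
    simp only [Pi.mul_apply]
    ring
  rw [key, hadd.integral_pow_four, hsub.integral_pow_four, hZ.integral_pow_four,
    hY.integral_pow_four]
  ring

end IsCentredGaussian

/-! ### Riemann-Stieltjes sums -/

/-- Summation by parts. It serves both the Stieltjes sums and the Abel bound `abs_sum_mul_le`. -/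
lemma sum_mul_sub_eq (f w : ℕ → ℝ) (q : ℕ) :
    ∑ l ∈ Finset.range q, f l * (w (l + 1) - w l)
      = f q * w q - f 0 * w 0 - ∑ l ∈ Finset.range q, (f (l + 1) - f l) * w (l + 1) := by
  induction q with
  | zero => simp
  | succ q ih => rw [Finset.sum_range_succ, ih, Finset.sum_range_succ]; ring

/-- Summation by parts moves the differences onto the smooth factor f, and each difference of f is
an integral of f'. The error is then an integral of f' times an oscillation of w over one cell, so
uniform continuity of w suffices and no bounded variation is required. -/
lemma tendsto_stieltjes_sum {f f' w : ℝ → ℝ} (hf : ∀ s, HasDerivAt f (f' s) s)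
    (hf' : Continuous f') (hw : Continuous w) {t : ℝ} (ht : 0 ≤ t) :
    Tendsto (fun q : ℕ => ∑ l ∈ Finset.range q,
        f (l * (t / q)) * (w ((l + 1 : ℝ) * (t / q)) - w (l * (t / q)))) atTop
      (𝓝 (f t * w t - f 0 * w 0 - ∫ s in (0 : ℝ)..t, f' s * w s)) := by
  obtain ⟨M, hM⟩ := (isCompact_Icc (a := (0 : ℝ)) (b := t)).exists_bound_of_continuousOn
    hf'.continuousOn
  have hM0 : 0 ≤ M := (norm_nonneg _).trans (hM 0 ⟨le_rfl, ht⟩)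
  rw [Metric.tendsto_atTop]
  intro ε hε
  set ε' := ε / (M * t + 1) with hε'
  have hMt : 0 ≤ M * t := mul_nonneg hM0 ht
  have hε'0 : 0 < ε' := div_pos hε (by linarith)
  have huc := (isCompact_Icc (a := (0 : ℝ)) (b := t)).uniformContinuousOn_of_continuous
    hw.continuousOn
  rw [Metric.uniformContinuousOn_iff] at huc
  obtain ⟨δ, hδ, hδw⟩ := huc ε' hε'0
  obtain ⟨Q, hQ⟩ := exists_nat_gt (t / δ)
  refine ⟨Q + 1, fun q hq => ?_⟩
  have hq0 : (0 : ℝ) < q := by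
    have : 0 < q := by omega
    exact_mod_cast this
  have hqt : (q : ℝ) * (t / q) = t := by field_simp
  set h := t / q with hh
  have hh0 : 0 ≤ h := div_nonneg ht hq0.le
  have hhδ : h < δ := by
    have h1 : (Q : ℝ) < q := by exact_mod_cast (by omega : Q < q)
    rw [hh, div_lt_iff₀ hq0]
    rw [div_lt_iff₀ hδ] at hQ
    nlinarith
  have hmem : ∀ l ∈ Finset.range q, ∀ s ∈ Icc ((l : ℝ) * h) (((l : ℝ) + 1) * h), s ∈ Icc 0 t := by
    intro l hl s hs
    have hl' : (l : ℝ) + 1 ≤ q := by exact_mod_cast Finset.mem_range.1 hl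
    refine ⟨le_trans (by positivity) hs.1, hs.2.trans ?_⟩
    rw [← hqt]
    exact mul_le_mul_of_nonneg_right hl' hh0
  have hint : ∀ a b : ℝ, IntervalIntegrable (fun s => f' s * w s) volume a b :=
    fun a b => (hf'.mul hw).intervalIntegrable a b
  have e1 := sum_mul_sub_eq (fun l => f (l * h)) (fun l => w (l * h)) q
  simp only [Nat.cast_add, Nat.cast_one, Nat.cast_zero, zero_mul, hqt] at e1
  have e2 : ∫ s in (0 : ℝ)..t, f' s * w s
      = ∑ l ∈ Finset.range q, ∫ s in ((l : ℝ) * h)..(((l : ℝ) + 1) * h), f' s * w s := by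
    have := intervalIntegral.sum_integral_adjacent_intervals (f := fun s => f' s * w s)
      (μ := volume) (a := fun l : ℕ => (l : ℝ) * h) (n := q) (fun k _ => hint _ _)
    simp only [Nat.cast_add, Nat.cast_one, Nat.cast_zero, zero_mul, hqt] at this
    exact this.symm
  rw [e1, e2, Real.dist_eq]
  have e3 : f t * w t - f 0 * w 0
        - ∑ l ∈ Finset.range q, (f (((l : ℝ) + 1) * h) - f (l * h)) * w (((l : ℝ) + 1) * h)
        - (f t * w t - f 0 * w 0
          - ∑ l ∈ Finset.range q, ∫ s in ((l : ℝ) * h)..(((l : ℝ) + 1) * h), f' s * w s)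
      = ∑ l ∈ Finset.range q, ∫ s in ((l : ℝ) * h)..(((l : ℝ) + 1) * h),
          f' s * (w s - w (((l : ℝ) + 1) * h)) := by
    rw [sub_sub_sub_cancel_left, ← Finset.sum_sub_distrib]
    refine Finset.sum_congr rfl fun l _ => ?_
    have hc : Continuous fun s => f' s * w (((l : ℝ) + 1) * h) := hf'.mul continuous_const
    simp only [mul_sub]
    rw [intervalIntegral.integral_sub (hint _ _) (hc.intervalIntegrable _ _), intervalIntegral.integral_mul_const,
      intervalIntegral.integral_eq_sub_of_hasDerivAt (fun x _ => hf x)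
        (hf'.intervalIntegrable _ _)]
  rw [e3]
  calc |∑ l ∈ Finset.range q, ∫ s in ((l : ℝ) * h)..(((l : ℝ) + 1) * h),
          f' s * (w s - w (((l : ℝ) + 1) * h))|
      ≤ ∑ l ∈ Finset.range q, M * ε' * h := by
        refine (Finset.abs_sum_le_sum_abs _ _).trans (Finset.sum_le_sum fun l hl => ?_)
        have hle : (l : ℝ) * h ≤ ((l : ℝ) + 1) * h := by nlinarith
        have := intervalIntegral.norm_integral_le_of_norm_le_const (C := M * ε')
          (a := (l : ℝ) * h) (b := ((l : ℝ) + 1) * h)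
          (f := fun s => f' s * (w s - w (((l : ℝ) + 1) * h))) (fun s hs => ?_)
        · rw [Real.norm_eq_abs] at this
          refine this.trans (le_of_eq ?_)
          rw [show ((l : ℝ) + 1) * h - l * h = h by ring, abs_of_nonneg hh0]
        · rw [uIoc_of_le hle] at hs
          rw [norm_mul]
          have hs' := hmem l hl s ⟨hs.1.le, hs.2⟩
          refine mul_le_mul (hM s hs') ?_ (norm_nonneg _) hM0
          have := hδw s hs' (((l : ℝ) + 1) * h) (hmem l hl _ ⟨hle, le_rfl⟩) ?_
          · rw [Real.dist_eq] at this
            exact this.le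
          · rw [Real.dist_eq, abs_lt]
            constructor <;> nlinarith [hs.1, hs.2]
    _ = M * t * ε' := by
        rw [Finset.sum_const, Finset.card_range, nsmul_eq_mul]
        calc (q : ℝ) * (M * ε' * h) = M * ε' * (q * h) := by ring
          _ = M * t * ε' := by rw [hqt]; ring
    _ < ε := by
        rw [hε', mul_div_assoc', div_lt_iff₀ (by linarith)]
        nlinarith

lemma mesh_nonneg (n : ℕ) : 0 ≤ mesh n := by unfold mesh; positivity

/-- Refining every cell of the time grid into m pieces gives a single partition that contains all
grid times. Integrals up to different times can thus be approximated with the same Brownian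
increments. -/
lemma tendsto_stieltjes_sum_grid {f f' w : ℝ → ℝ} (hf : ∀ s, HasDerivAt f (f' s) s)
    (hf' : Continuous f') (hw : Continuous w) (n j : ℕ) :
    Tendsto (fun m : ℕ => ∑ l ∈ Finset.range (j * m),
        f (l * (mesh n / m)) * (w ((l + 1 : ℝ) * (mesh n / m)) - w (l * (mesh n / m)))) atTop
      (𝓝 (f (j * mesh n) * w (j * mesh n) - f 0 * w 0
        - ∫ s in (0 : ℝ)..(j * mesh n), f' s * w s)) := by
  rcases Nat.eq_zero_or_pos j with rfl | hj
  · simp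
  have h1 := tendsto_stieltjes_sum hf hf' hw (t := j * mesh n)
    (mul_nonneg (Nat.cast_nonneg _) (mesh_nonneg n))
  have h2 : Tendsto (fun m : ℕ => j * m) atTop atTop :=
    tendsto_id.const_mul_atTop' hj
  refine (h1.comp h2).congr fun m => ?_
  have e : (j : ℝ) * mesh n / ((j * m : ℕ) : ℝ) = mesh n / m := by
    push_cast
    exact mul_div_mul_left _ _ (by positivity)
  simp only [Function.comp_apply, e]

/-! ### Gaussianity of the coordinate processes -/

lemma eigenvalue_pos {θ : Fin 3 → ℝ} (hθ : 0 < θ 2) (hpos : 0 < eigenvalue θ 1) (k : ℕ) :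
    0 < eigenvalue θ (k + 1) := by
  unfold eigenvalue at *
  have : (1 : ℝ) ≤ ((k + 1 : ℕ) : ℝ) ^ 2 := by
    have : (1 : ℝ) ≤ ((k + 1 : ℕ) : ℝ) := by push_cast; linarith [k.cast_nonneg (α := ℝ)]
    nlinarith
  have h2 : 0 < Real.pi ^ 2 * θ 2 := by positivity
  have : Real.pi ^ 2 * θ 2 * 1 ≤ Real.pi ^ 2 * θ 2 * ((k + 1 : ℕ) : ℝ) ^ 2 :=
    mul_le_mul_of_nonneg_left this h2.le
  norm_num at hpos
  nlinarith

/-- The integrand of the stochastic convolution in a mode with eigenvalue `lam`. -/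
def convKernel (σ lam t s : ℝ) : ℝ := Real.exp (-lam * (t - s)) * σ

lemma hasDerivAt_convKernel (σ lam t s : ℝ) :
    HasDerivAt (convKernel σ lam t) (lam * convKernel σ lam t s) s := by
  have h1 : HasDerivAt (fun s => -lam * (t - s)) lam s := by
    refine (((hasDerivAt_id' s).const_sub t).const_mul (-lam)).congr_deriv ?_
    ring
  refine (h1.exp.mul_const σ).congr_deriv ?_
  unfold convKernel; ring

lemma continuous_convKernel (σ lam t : ℝ) : Continuous (convKernel σ lam t) :=
  continuous_iff_continuousAt.2 fun s => (hasDerivAt_convKernel σ lam t s).continuousAt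

/-- These sums are Stieltjes sums with integrator `id`. Their limit is the integral of the product
of two kernels, that is, the Itô isometry for the stochastic convolutions. -/
lemma tendsto_sum_convKernel_mul {lam : ℝ} (hlam : lam ≠ 0) (σ t t' : ℝ) (n j : ℕ) :
    Tendsto (fun m : ℕ => ∑ l ∈ Finset.range (j * m),
        convKernel σ lam t (l * (mesh n / m)) * convKernel σ lam t' (l * (mesh n / m))
          * (mesh n / m)) atTop
      (𝓝 (σ ^ 2 / (2 * lam) * (Real.exp (-lam * (t + t' - 2 * (j * mesh n)))
        - Real.exp (-lam * (t + t'))))) := by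
  have hd : ∀ s, HasDerivAt (fun s => convKernel σ lam t s * convKernel σ lam t' s)
      (2 * lam * (convKernel σ lam t s * convKernel σ lam t' s)) s := fun s => by
    refine ((hasDerivAt_convKernel σ lam t s).mul
      (hasDerivAt_convKernel σ lam t' s)).congr_deriv ?_
    ring
  have hc : Continuous fun s => 2 * lam * (convKernel σ lam t s * convKernel σ lam t' s) :=
    continuous_const.mul ((continuous_convKernel σ lam t).mul (continuous_convKernel σ lam t'))
  have h1 := tendsto_stieltjes_sum_grid hd hc continuous_id n j
  have e : ∀ s, convKernel σ lam t s * convKernel σ lam t' s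
      = σ ^ 2 * Real.exp (-lam * (t + t' - 2 * s)) := fun s => by
    unfold convKernel
    rw [show -lam * (t + t' - 2 * s) = -lam * (t - s) + -lam * (t' - s) by ring, Real.exp_add]
    ring
  have h2 : ∫ s in (0 : ℝ)..(j * mesh n),
      2 * lam * (convKernel σ lam t s * convKernel σ lam t' s) * id s
      = (convKernel σ lam t (j * mesh n) * convKernel σ lam t' (j * mesh n)) * (j * mesh n)
        - (convKernel σ lam t (j * mesh n) * convKernel σ lam t' (j * mesh n)) / (2 * lam)
        + (convKernel σ lam t 0 * convKernel σ lam t' 0) / (2 * lam) := by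
    rw [intervalIntegral.integral_eq_sub_of_hasDerivAt
      (f := fun s => convKernel σ lam t s * convKernel σ lam t' s * s
        - convKernel σ lam t s * convKernel σ lam t' s / (2 * lam))]
    · ring
    · intro s _
      refine (((hd s).mul (hasDerivAt_id' s)).sub ((hd s).div_const (2 * lam))).congr_deriv ?_
      simp only [id]
      field_simp
      ring
    · exact (hc.mul continuous_id).intervalIntegrable _ _
  rw [h2] at h1
  convert h1.congr fun m => ?_ using 2
  · rw [e, e]
    simp only [id, mul_zero, sub_zero]
    field_simp
    ring
  · refine Finset.sum_congr rfl fun l _ => ?_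
    simp only [id]
    ring

section

variable {Ω : Type*} [MeasurableSpace Ω] {P : Measure Ω} [IsProbabilityMeasure P]

lemma isCentredGaussian_brownian_sum {B : ℝ≥0 → Ω → ℝ} (hB : IsPreBrownianReal B P) {h : ℝ}
    (h0 : 0 ≤ h) (g : ℕ → ℝ) (L : ℕ) :
    IsCentredGaussian P (fun ω => ∑ l ∈ Finset.range L,
        g l * (B (((l : ℝ) + 1) * h).toNNReal ω - B ((l : ℝ) * h).toNNReal ω))
      (∑ l ∈ Finset.range L, g l ^ 2 * h) := by
  have hmono : Monotone fun l : ℕ => ((l : ℝ) * h).toNNReal := fun a b hab =>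
    Real.toNNReal_le_toNNReal (mul_le_mul_of_nonneg_right (by exact_mod_cast hab) h0)
  have hind := hB.hasIndepIncrements.nat hmono
  have hind' := hind.comp (fun l x => g l * x) (fun l => by fun_prop)
  refine IsCentredGaussian.sum_of_iIndepFun (Finset.range L) (fun l => ?_) (by
    simpa [Function.comp_def] using hind')
  refine IsCentredGaussian.const_mul ⟨h0, ?_⟩ (g l)
  have hlaw := hB.hasLaw_sub (((l : ℝ) + 1) * h).toNNReal ((l : ℝ) * h).toNNReal
  have e1 : 0 ≤ ((l : ℝ) + 1) * h := by positivity
  have e2 : 0 ≤ (l : ℝ) * h := by positivity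
  have hv : nndist ((((l : ℝ) + 1) * h).toNNReal : ℝ) (((l : ℝ) * h).toNNReal : ℝ)
      = h.toNNReal := by
    apply NNReal.eq
    rw [coe_nndist, Real.coe_toNNReal _ h0, Real.coe_toNNReal _ e1, Real.coe_toNNReal _ e2,
      Real.dist_eq, show ((l : ℝ) + 1) * h - l * h = h by ring, abs_of_nonneg h0]
  rw [← hv]
  exact hlaw

/-- Independence enters three times: between the initial coefficients, between the modes of the
noise, and between initial value and noise. Within one mode the Brownian increments are independent
as well. -/
lemma isCentredGaussian_modes_sum {ξ : ℕ → Ω → ℝ} {v : ℕ → ℝ} {W : ℕ → ℝ≥0 → Ω → ℝ}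
    (hξ : ∀ k, IsCentredGaussian P (ξ k) (v k)) (hξi : iIndepFun ξ P)
    (hW : ∀ k, IsPreBrownianReal (W k) P) (hWi : iIndepFun (fun k ω => fun t => W k t ω) P)
    (hξW : IndepFun (fun ω => fun k : ℕ => ξ k ω) (fun ω => fun (k : ℕ) (t : ℝ≥0) => W k t ω) P)
    {h : ℝ} (h0 : 0 ≤ h) (α : ℕ → ℝ) (g : ℕ → ℕ → ℝ) (L N : ℕ) :
    IsCentredGaussian P (fun ω => (∑ k ∈ Finset.range N, α k * ξ k ω)
        + ∑ k ∈ Finset.range N, ∑ l ∈ Finset.range L,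
          g k l * (W k (((l : ℝ) + 1) * h).toNNReal ω - W k ((l : ℝ) * h).toNNReal ω))
      ((∑ k ∈ Finset.range N, α k ^ 2 * v k)
        + ∑ k ∈ Finset.range N, ∑ l ∈ Finset.range L, g k l ^ 2 * h) := by
  refine IsCentredGaussian.add_of_indepFun ?_ ?_ ?_
  · refine IsCentredGaussian.sum_of_iIndepFun _ (fun k => (hξ k).const_mul (α k)) ?_
    exact hξi.comp (fun k x => α k * x) (fun k => by fun_prop)
  · refine IsCentredGaussian.sum_of_iIndepFun _
      (fun k => isCentredGaussian_brownian_sum (hW k) h0 (g k) L) ?_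
    exact hWi.comp (fun k (w : ℝ≥0 → ℝ) => ∑ l ∈ Finset.range L,
      g k l * (w (((l : ℝ) + 1) * h).toNNReal - w ((l : ℝ) * h).toNNReal))
      (fun k => by fun_prop)
  · exact hξW.comp (φ := fun x : ℕ → ℝ => ∑ k ∈ Finset.range N, α k * x k)
      (ψ := fun w : ℕ → ℝ≥0 → ℝ => ∑ k ∈ Finset.range N, ∑ l ∈ Finset.range L,
        g k l * (w k (((l : ℝ) + 1) * h).toNNReal - w k ((l : ℝ) * h).toNNReal))
      (by fun_prop) (by fun_prop)

end

lemma sum_range_indicator {a b : ℕ} (hab : a ≤ b) (f : ℕ → ℝ) :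
    ∑ l ∈ Finset.range b, (if l < a then f l else 0) = ∑ l ∈ Finset.range a, f l := by
  rw [← Finset.sum_filter]
  congr 1
  ext l
  simp only [Finset.mem_filter, Finset.mem_range]
  omega

/-- Finite linear combinations of the coordinate processes at grid times are Gaussian, with the
covariance structure of independent stationary Ornstein-Uhlenbeck processes. -/
lemma isCentredGaussian_coord_sum {Ω : Type*} [MeasurableSpace Ω] {P : Measure Ω}
    [IsProbabilityMeasure P] {θ : Fin 3 → ℝ} (hθ : 0 < θ 2) (hpos : 0 < eigenvalue θ 1) {σ : ℝ}
    {W : ℕ → ℝ≥0 → Ω → ℝ} {X : ℝ → ℝ → Ω → ℝ} (hX : IsStationarySolution P θ σ W X)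
    {ι : Type*} [Fintype ι] {n : ℕ} (hn : 0 < n) (τ : ι → ℕ) (hτ : ∀ a, τ a ≤ n)
    (d : ℕ → ι → ℝ) (N : ℕ) :
    IsCentredGaussian P
      (fun ω => ∑ k ∈ Finset.range N, ∑ a, d k a * coord θ X (k + 1) (τ a * mesh n) ω)
      (∑ k ∈ Finset.range N, ∑ a, ∑ b, d k a * d k b * (σ ^ 2 / (2 * eigenvalue θ (k + 1))
        * Real.exp (-eigenvalue θ (k + 1) * (|(τ a : ℝ) - τ b| * mesh n)))) := by
  have hlam := eigenvalue_pos hθ hpos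
  have hmesh := mesh_nonneg n
  set ξ : ℕ → Ω → ℝ := fun k => coord θ X (k + 1) 0 with hξdef
  set lam : ℕ → ℝ := fun k => eigenvalue θ (k + 1) with hlamdef
  have hξ : ∀ k, IsCentredGaussian P (ξ k) (σ ^ 2 / (2 * lam k)) := fun k =>
    ⟨div_nonneg (sq_nonneg _) (by have := hlam k; positivity), hX.init_law k⟩
  set α : ℕ → ℝ := fun k => ∑ a, d k a * Real.exp (-lam k * (τ a * mesh n)) with hα
  -- The cut-off `l < τ a * m` stops each stochastic integral at its own time, while all of them are
  -- sums over one common partition. The joint linear combination is thus a single sum of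
  -- independent increments.
  set g : ℕ → ℕ → ℕ → ℝ := fun m k l => ∑ a, d k a *
    (if l < τ a * m then convKernel σ (lam k) (τ a * mesh n) (l * (mesh n / m)) else 0) with hg
  have hle : ∀ a m, τ a * m ≤ n * m := fun a m => Nat.mul_le_mul_right m (hτ a)
  -- the approximating variables
  have hG := fun m : ℕ => isCentredGaussian_modes_sum hξ hX.init_indep
    (fun k => (hX.brownian k).toIsPreBrownianReal) hX.indep_brownian hX.init_indep_noise
    (h := mesh n / m) (by positivity) α (g m) (n * m) N
  refine IsCentredGaussian.of_tendsto hG ?_ ?_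
  · have hmild : ∀ᵐ ω ∂P, ∀ k a, coord θ X (k + 1) (τ a * mesh n) ω
        = Real.exp (-lam k * (τ a * mesh n)) * ξ k ω
          + wienerIntegral (convKernel σ (lam k) (τ a * mesh n)) (fun s => W k s ω)
            (τ a * mesh n) := by
      rw [ae_all_iff]
      intro k
      rw [ae_all_iff]
      intro a
      refine hX.mild (τ a * mesh n) ⟨by positivity, ?_⟩ k
      have : (τ a : ℝ) ≤ n := by exact_mod_cast hτ a
      have hn' : (0 : ℝ) < n := by exact_mod_cast hn
      rw [mesh, mul_one_div, div_le_one hn']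
      exact this
    have hcont : ∀ᵐ ω ∂P, ∀ k, Continuous (fun t => W k t ω) :=
      ae_all_iff.2 fun k => (hX.brownian k).cont
    filter_upwards [hmild, hcont] with ω h1 h2
    have e1 : ∑ k ∈ Finset.range N, ∑ a, d k a * coord θ X (k + 1) (τ a * mesh n) ω
        = (∑ k ∈ Finset.range N, α k * ξ k ω) + ∑ k ∈ Finset.range N, ∑ a, d k a
          * wienerIntegral (convKernel σ (lam k) (τ a * mesh n)) (fun s => W k s ω)
            (τ a * mesh n) := by
      rw [← Finset.sum_add_distrib]
      refine Finset.sum_congr rfl fun k _ => ?_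
      rw [hα, Finset.sum_mul, ← Finset.sum_add_distrib]
      refine Finset.sum_congr rfl fun a _ => ?_
      rw [h1 k a]
      ring
    rw [e1]
    refine tendsto_const_nhds.add (tendsto_finsetSum _ fun k _ => ?_)
    have e2 : ∀ m : ℕ, ∑ l ∈ Finset.range (n * m), g m k l *
          (W k (((l : ℝ) + 1) * (mesh n / m)).toNNReal ω - W k ((l : ℝ) * (mesh n / m)).toNNReal ω)
        = ∑ a, d k a * ∑ l ∈ Finset.range (τ a * m),
          convKernel σ (lam k) (τ a * mesh n) (l * (mesh n / m)) *
          (W k (((l : ℝ) + 1) * (mesh n / m)).toNNReal ω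
            - W k ((l : ℝ) * (mesh n / m)).toNNReal ω) := by
      intro m
      simp only [hg, Finset.sum_mul]
      rw [Finset.sum_comm]
      refine Finset.sum_congr rfl fun a _ => ?_
      rw [← sum_range_indicator (hle a m), Finset.mul_sum]
      refine Finset.sum_congr rfl fun l _ => ?_
      split_ifs <;> ring
    simp only [e2]
    refine tendsto_finsetSum _ fun a _ => Tendsto.const_mul _ ?_
    have := tendsto_stieltjes_sum_grid (hasDerivAt_convKernel σ (lam k) (τ a * mesh n))
      (continuous_const.mul (continuous_convKernel σ (lam k) (τ a * mesh n)))
      ((h2 k).comp continuous_real_toNNReal) n (τ a)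
    simpa only [wienerIntegral, (hasDerivAt_convKernel σ (lam k) (τ a * mesh n) _).deriv,
      Function.comp_apply, Real.toNNReal_zero] using this
  -- Up to the factor σ²/(2λ), the stationary covariance e^(-λ|s-t|) splits into e^(-λ(s+t)),
  -- contributed by the initial value, and the remainder, contributed by the noise on [0, min(s,
  -- t)].
  · rw [show (∑ k ∈ Finset.range N, ∑ a, ∑ b, d k a * d k b * (σ ^ 2 / (2 * lam k)
        * Real.exp (-lam k * (|(τ a : ℝ) - τ b| * mesh n))))
        = (∑ k ∈ Finset.range N, α k ^ 2 * (σ ^ 2 / (2 * lam k)))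
          + ∑ k ∈ Finset.range N, ∑ a, ∑ b, d k a * d k b * (σ ^ 2 / (2 * lam k)
            * (Real.exp (-lam k * (|(τ a : ℝ) - τ b| * mesh n))
              - Real.exp (-lam k * (τ a * mesh n + τ b * mesh n)))) from ?_]
    · refine tendsto_const_nhds.add (tendsto_finsetSum _ fun k _ => ?_)
      have e2 : ∀ m : ℕ, ∑ l ∈ Finset.range (n * m), g m k l ^ 2 * (mesh n / m)
          = ∑ a, ∑ b, d k a * d k b * ∑ l ∈ Finset.range (min (τ a) (τ b) * m),
            convKernel σ (lam k) (τ a * mesh n) (l * (mesh n / m))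
            * convKernel σ (lam k) (τ b * mesh n) (l * (mesh n / m)) * (mesh n / m) := by
        intro m
        have e3 : ∀ l, g m k l ^ 2 * (mesh n / m) = ∑ a, ∑ b, (d k a *
            (if l < τ a * m then convKernel σ (lam k) (τ a * mesh n) (l * (mesh n / m)) else 0)) *
            (d k b * (if l < τ b * m then
              convKernel σ (lam k) (τ b * mesh n) (l * (mesh n / m)) else 0)) * (mesh n / m) := by
          intro l
          simp only [hg]
          rw [sq, Finset.sum_mul_sum, Finset.sum_mul]
          exact Finset.sum_congr rfl fun a _ => Finset.sum_mul _ _ _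
        simp only [e3]
        rw [Finset.sum_comm]
        refine Finset.sum_congr rfl fun a _ => ?_
        rw [Finset.sum_comm]
        refine Finset.sum_congr rfl fun b _ => ?_
        rw [← sum_range_indicator ((Nat.mul_le_mul_right m (min_le_left _ _)).trans (hle a m)),
          Finset.mul_sum]
        refine Finset.sum_congr rfl fun l _ => ?_
        have hmin : (l < min (τ a) (τ b) * m) ↔ (l < τ a * m ∧ l < τ b * m) := by
          rw [← Nat.mul_min_mul_right, lt_min_iff]
        simp only [hmin]
        by_cases ha : l < τ a * m <;> by_cases hb : l < τ b * m <;>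
          simp only [ha, hb, and_self, and_true, and_false, if_true, if_false] <;> ring
      simp only [e2]
      refine tendsto_finsetSum _ fun a _ => tendsto_finsetSum _ fun b _ => Tendsto.const_mul _ ?_
      have := tendsto_sum_convKernel_mul (hlam k).ne' σ (τ a * mesh n) (τ b * mesh n) n
        (min (τ a) (τ b))
      convert this using 6
      rcases le_total (τ a) (τ b) with hab | hab
      · have hab' : (τ a : ℝ) ≤ τ b := by exact_mod_cast hab
        rw [min_eq_left hab, abs_of_nonpos (by linarith)]
        ring
      · have hab' : (τ b : ℝ) ≤ τ a := by exact_mod_cast hab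
        rw [min_eq_right hab, abs_of_nonneg (by linarith)]
        ring
    · rw [← Finset.sum_add_distrib]
      refine Finset.sum_congr rfl fun k _ => ?_
      rw [show α k ^ 2 = ∑ a, ∑ b, (d k a * Real.exp (-lam k * (τ a * mesh n)))
          * (d k b * Real.exp (-lam k * (τ b * mesh n))) by
        rw [sq, hα, Finset.sum_mul_sum], Finset.sum_mul, ← Finset.sum_add_distrib]
      refine Finset.sum_congr rfl fun a _ => ?_
      rw [Finset.sum_mul, ← Finset.sum_add_distrib]
      refine Finset.sum_congr rfl fun b _ => ?_
      rw [mul_add, Real.exp_add]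
      ring

/-! ### Recovering a continuous function from its sine coefficients -/

lemma HasSum.of_eq {f g : ℕ → ℝ} {a b : ℝ} (h : HasSum g b) (hf : ∀ k, f k = g k) (ha : a = b) :
    HasSum f a := by rwa [ha, funext hf]

/-- This is the Fourier series of the second Bernoulli polynomial at w/2. -/
lemma hasSum_cos_div_sq {w : ℝ} (hw : w ∈ Icc (0 : ℝ) 2) :
    HasSum (fun k : ℕ => Real.cos (Real.pi * (k + 1) * w) / (k + 1 : ℝ) ^ 2)
      (Real.pi ^ 2 * (w ^ 2 / 4 - w / 2 + 1 / 6)) := by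
  have h := hasSum_one_div_nat_pow_mul_cos (k := 1) one_ne_zero (x := w / 2)
    ⟨by linarith [hw.1], by linarith [hw.2]⟩
  rw [← hasSum_nat_add_iff' 1] at h
  have hB : ((Polynomial.bernoulli (2 * 1)).map (algebraMap ℚ ℝ)).eval (w / 2)
      = w ^ 2 / 4 - w / 2 + 1 / 6 := by
    simp only [mul_one, Polynomial.bernoulli, Finset.sum_range_succ, Finset.sum_range_zero,
      bernoulli_zero, bernoulli_one, bernoulli_two, Polynomial.map_add, Polynomial.map_monomial,
      Polynomial.eval_add, Polynomial.eval_monomial]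
    norm_num
    ring
  rw [hB] at h
  refine HasSum.of_eq h (fun k => ?_) ?_
  · push_cast
    rw [show 2 * Real.pi * ((k : ℝ) + 1) * (w / 2) = Real.pi * (k + 1) * w by ring]
    ring
  · rw [show ((Nat.factorial (2 * 1) : ℕ) : ℝ) = 2 by norm_num [Nat.factorial]]
    simp only [Finset.sum_range_one, Nat.cast_zero, mul_one, ne_eq, OfNat.ofNat_ne_zero,
      not_false_eq_true, zero_pow, div_zero, zero_mul, sub_zero]
    ring

/-- The sine expansion of the Green function of the Dirichlet Laplacian. -/
lemma hasSum_green {y z : ℝ} (hy : y ∈ Icc (0 : ℝ) 1) (hz : z ∈ Icc (0 : ℝ) 1) :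
    HasSum (fun k : ℕ => 2 * Real.sin (Real.pi * (k + 1) * y) * Real.sin (Real.pi * (k + 1) * z)
      / (Real.pi * (k + 1)) ^ 2) (min y z - y * z) := by
  have h1 := hasSum_cos_div_sq (w := |y - z|)
    ⟨abs_nonneg _, by rw [abs_le]; constructor <;> linarith [hy.1, hy.2, hz.1, hz.2]⟩
  have h2 := hasSum_cos_div_sq (w := y + z) ⟨by linarith [hy.1, hz.1], by linarith [hy.2, hz.2]⟩
  have h := (h1.sub h2).div_const (Real.pi ^ 2)
  have hpi := Real.pi_pos
  refine HasSum.of_eq h (fun k => ?_) ?_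
  · have e : Real.cos (Real.pi * (k + 1) * |y - z|) = Real.cos (Real.pi * (k + 1) * (y - z)) := by
      rw [← Real.cos_abs (Real.pi * (k + 1) * (y - z)), abs_mul,
        abs_of_nonneg (by positivity : (0 : ℝ) ≤ Real.pi * (k + 1))]
    rw [e, mul_sub (Real.pi * ((k : ℝ) + 1)), mul_add (Real.pi * ((k : ℝ) + 1)), Real.cos_sub,
      Real.cos_add]
    field_simp
    ring
  · rw [min_def]
    field_simp
    split_ifs with hyz
    · rw [abs_of_nonpos (by linarith)]; ring
    · rw [abs_of_pos (by linarith)]; ring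

/-- The Fourier multiplier of the hat function of width `ε` in the mode `k + 1`. -/
def hatMult (ε : ℝ) (k : ℕ) : ℝ :=
  (2 - 2 * Real.cos (Real.pi * (k + 1) * ε)) / (Real.pi * (k + 1) * ε) ^ 2

/-- The normalized hat function of width `ε` around `y`. -/
def hat (y ε z : ℝ) : ℝ := (2 * min y z - min (y + ε) z - min (y - ε) z) / ε ^ 2

lemma hatMult_nonneg (ε : ℝ) (k : ℕ) : 0 ≤ hatMult ε k :=
  div_nonneg (by linarith [Real.cos_le_one (Real.pi * (k + 1) * ε)]) (sq_nonneg _)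

lemma hatMult_le_one (ε : ℝ) (k : ℕ) : hatMult ε k ≤ 1 := by
  refine div_le_one_of_le₀ ?_ (sq_nonneg _)
  linarith [Real.one_sub_sq_div_two_le_cos (x := Real.pi * (k + 1) * ε)]

/-- For fixed width this quadratic decay makes the smoothed sine series absolutely convergent. The
bound by 1 in `hatMult_le_one` is the one that stays uniform as the width tends to 0. -/
lemma hatMult_le (ε : ℝ) (k : ℕ) : hatMult ε k ≤ 4 / (Real.pi * ε) ^ 2 * (1 / (k + 1 : ℝ) ^ 2) := by
  have : hatMult ε k ≤ 4 / (Real.pi * (k + 1) * ε) ^ 2 :=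
    div_le_div_of_nonneg_right (by linarith [Real.neg_one_le_cos (Real.pi * (k + 1) * ε)])
      (sq_nonneg _)
  refine this.trans (le_of_eq ?_)
  rw [div_mul_div_comm]
  ring

lemma summable_one_div_succ_sq : Summable fun k : ℕ => 1 / (k + 1 : ℝ) ^ 2 := by
  have := (summable_nat_add_iff 1).2 (Real.summable_one_div_nat_pow.2 one_lt_two)
  simpa using this

lemma tendsto_hatMult (k : ℕ) {ε : ℕ → ℝ} (hε0 : ∀ m, ε m ≠ 0) (hε : Tendsto ε atTop (𝓝 0)) :
    Tendsto (fun m => hatMult (ε m) k) atTop (𝓝 1) := by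
  have hc : (Real.pi * (k + 1) : ℝ) ≠ 0 := by positivity
  -- By the half-angle formula the multiplier is sinc² at π(k+1)ε/2.
  have h1 : Tendsto (fun m => Real.sinc (Real.pi * (k + 1) * ε m / 2) ^ 2) atTop (𝓝 1) := by
    have : Continuous fun x : ℝ => Real.sinc (Real.pi * (k + 1) * x / 2) ^ 2 := by fun_prop
    have := (this.tendsto 0).comp hε
    simpa [Function.comp_def] using this
  refine h1.congr fun m => ?_
  have hx : Real.pi * (k + 1) * ε m / 2 ≠ 0 := by
    have := hε0 m
    positivity
  rw [Real.sinc_of_ne_zero hx, div_pow, Real.sin_sq_eq_half_sub, hatMult,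
    show 2 * (Real.pi * (k + 1) * ε m / 2) = Real.pi * (k + 1) * ε m by ring]
  rw [div_pow, div_eq_div_iff (by have := hε0 m; positivity) (by have := hε0 m; positivity)]
  ring

/-- The hat is minus the second difference in y of the Green function, divided by ε². The bilinear
part y·z drops out, and on sin(π(k+1)y) the second difference acts as multiplication by 2 -
2cos(π(k+1)ε). -/
lemma hasSum_hat {y ε z : ℝ} (hε : 0 < ε) (h0 : 0 ≤ y - ε) (h1 : y + ε ≤ 1)
    (hz : z ∈ Icc (0 : ℝ) 1) :
    HasSum (fun k : ℕ => hatMult ε k * (2 * Real.sin (Real.pi * (k + 1) * y))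
      * Real.sin (Real.pi * (k + 1) * z)) (hat y ε z) := by
  have a := hasSum_green (y := y) (z := z) ⟨by linarith, by linarith⟩ hz
  have b := hasSum_green (y := y + ε) (z := z) ⟨by linarith, by linarith⟩ hz
  have c := hasSum_green (y := y - ε) (z := z) ⟨by linarith, by linarith⟩ hz
  refine HasSum.of_eq ((((a.mul_left 2).sub b).sub c).div_const (ε ^ 2)) (fun k => ?_) ?_
  · have hp : (Real.pi * (k + 1) : ℝ) ≠ 0 := by positivity
    rw [mul_add (Real.pi * ((k : ℝ) + 1)), mul_sub (Real.pi * ((k : ℝ) + 1)), Real.sin_add,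
      Real.sin_sub, hatMult]
    field_simp
    ring
  · unfold hat
    ring

/-- This is concavity of y ↦ min(y, z). -/
lemma hat_nonneg {y ε : ℝ} (hε : 0 < ε) (z : ℝ) : 0 ≤ hat y ε z := by
  refine div_nonneg ?_ (sq_nonneg _)
  rcases min_cases y z with h | h <;> rcases min_cases (y + ε) z with h' | h' <;>
    rcases min_cases (y - ε) z with h'' | h'' <;> linarith [h.1, h.2, h'.1, h'.2, h''.1, h''.2]

lemma hat_eq_zero {y ε z : ℝ} (hε : 0 < ε) (hz : ε ≤ |z - y|) : hat y ε z = 0 := by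
  unfold hat
  rcases le_abs.1 hz with h | h
  · rw [min_eq_left (by linarith), min_eq_left (by linarith), min_eq_left (by linarith)]; ring
  · rw [min_eq_right (by linarith), min_eq_right (by linarith), min_eq_right (by linarith)]; ring

lemma continuous_hat (y ε : ℝ) : Continuous (hat y ε) := by unfold hat; fun_prop

lemma integral_min {c : ℝ} (h0 : 0 ≤ c) (h1 : c ≤ 1) :
    ∫ z in (0 : ℝ)..1, min c z = c - c ^ 2 / 2 := by
  have hi : ∀ a b : ℝ, IntervalIntegrable (fun z => min c z) volume a b := fun a b =>
    (by fun_prop : Continuous fun z => min c z).intervalIntegrable a b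
  rw [← intervalIntegral.integral_add_adjacent_intervals (hi 0 c) (hi c 1)]
  have e1 : ∫ z in (0 : ℝ)..c, min c z = ∫ z in (0 : ℝ)..c, z :=
    intervalIntegral.integral_congr fun z hz => by
      rw [uIcc_of_le h0] at hz
      exact min_eq_right hz.2
  have e2 : ∫ z in c..1, min c z = ∫ _ in c..1, c :=
    intervalIntegral.integral_congr fun z hz => by
      rw [uIcc_of_le h1] at hz
      exact min_eq_left hz.1
  rw [e1, e2, integral_id, intervalIntegral.integral_const, smul_eq_mul]
  ring

lemma integral_hat {y ε : ℝ} (hε : 0 < ε) (h0 : 0 ≤ y - ε) (h1 : y + ε ≤ 1) :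
    ∫ z in (0 : ℝ)..1, hat y ε z = 1 := by
  have hi : ∀ c : ℝ, IntervalIntegrable (fun z => min c z) volume 0 1 := fun c =>
    (by fun_prop : Continuous fun z => min c z).intervalIntegrable 0 1
  unfold hat
  rw [intervalIntegral.integral_div, intervalIntegral.integral_sub
    (((hi y).const_mul 2).sub (hi _)) (hi _), intervalIntegral.integral_sub
    ((hi y).const_mul 2) (hi _), intervalIntegral.integral_const_mul,
    integral_min (by linarith) (by linarith), integral_min (by linarith) (by linarith),
    integral_min (by linarith) (by linarith)]
  field_simp
  ring

lemma hasSum_integral_hat {f : ℝ → ℝ} (hf : ContinuousOn f (Icc 0 1)) {y ε : ℝ} (hε : 0 < ε)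
    (h0 : 0 ≤ y - ε) (h1 : y + ε ≤ 1) :
    HasSum (fun k : ℕ => hatMult ε k * (2 * Real.sin (Real.pi * (k + 1) * y))
      * ∫ z in (0 : ℝ)..1, f z * Real.sin (Real.pi * (k + 1) * z))
      (∫ z in (0 : ℝ)..1, f z * hat y ε z) := by
  obtain ⟨M, hM⟩ := isCompact_Icc.exists_bound_of_continuousOn hf
  have hf' : ContinuousOn f (uIcc 0 1) := by rwa [uIcc_of_le zero_le_one]
  have key := intervalIntegral.hasSum_integral_of_dominated_convergence (μ := volume)
    (a := (0 : ℝ)) (b := 1)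
    (F := fun (k : ℕ) z => f z * (hatMult ε k * (2 * Real.sin (Real.pi * (k + 1) * y))
      * Real.sin (Real.pi * (k + 1) * z))) (f := fun z => f z * hat y ε z)
    (fun k _ => M * (2 * (4 / (Real.pi * ε) ^ 2 * (1 / (k + 1 : ℝ) ^ 2)))) ?_ ?_ ?_ ?_ ?_
  · refine HasSum.of_eq key (fun k => ?_) rfl
    rw [← intervalIntegral.integral_const_mul]
    congr 1
    ext z
    ring
  · intro k
    have hc : ContinuousOn (fun z => hatMult ε k * (2 * Real.sin (Real.pi * (k + 1) * y))
        * Real.sin (Real.pi * (k + 1) * z)) (uIcc 0 1) := by fun_prop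
    exact ((hf'.mul hc).intervalIntegrable (μ := volume)).def'.aestronglyMeasurable
  · intro k
    refine ae_of_all _ fun z hz => ?_
    rw [uIoc_of_le zero_le_one] at hz
    have hz' : z ∈ Icc (0 : ℝ) 1 := ⟨hz.1.le, hz.2⟩
    rw [norm_mul]
    refine mul_le_mul (hM z hz') ?_ (norm_nonneg _) ((norm_nonneg _).trans (hM z hz'))
    rw [Real.norm_eq_abs, abs_mul, abs_mul, abs_mul, abs_of_nonneg (hatMult_nonneg ε k), abs_two]
    have a1 := Real.abs_sin_le_one (Real.pi * (k + 1) * y)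
    have a2 := Real.abs_sin_le_one (Real.pi * (k + 1) * z)
    have a3 := hatMult_nonneg ε k
    have a4 := hatMult_le ε k
    calc hatMult ε k * (2 * |Real.sin (Real.pi * (k + 1) * y)|) * |Real.sin (Real.pi * (k + 1) * z)|
        ≤ hatMult ε k * (2 * 1) * 1 := by gcongr
      _ ≤ _ := by linarith
  · exact ae_of_all _ fun z _ => ((summable_one_div_succ_sq.mul_left _).mul_left _).mul_left _
  · exact _root_.intervalIntegrable_const
  · refine ae_of_all _ fun z hz => ?_
    rw [uIoc_of_le zero_le_one] at hz
    exact (hasSum_hat hε h0 h1 ⟨hz.1.le, hz.2⟩).mul_left (f z)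

/-- The hats are an approximate identity: nonnegative, of mass one, and vanishing at distance at
least ε from y. -/
lemma tendsto_integral_hat {f : ℝ → ℝ} (hf : ContinuousOn f (Icc 0 1)) {y : ℝ} {ε : ℕ → ℝ}
    (hε0 : ∀ m, 0 < ε m) (hε : Tendsto ε atTop (𝓝 0)) (h0 : ∀ m, 0 ≤ y - ε m)
    (h1 : ∀ m, y + ε m ≤ 1) :
    Tendsto (fun m => ∫ z in (0 : ℝ)..1, f z * hat y (ε m) z) atTop (𝓝 (f y)) := by
  have hy : y ∈ Icc (0 : ℝ) 1 := ⟨by linarith [h0 0, hε0 0], by linarith [h1 0, hε0 0]⟩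
  have hf' : ContinuousOn f (uIcc 0 1) := by rwa [uIcc_of_le zero_le_one]
  rw [Metric.tendsto_atTop]
  intro η hη
  obtain ⟨δ, hδ, hδf⟩ := Metric.continuousOn_iff.1 hf y hy (η / 2) (half_pos hη)
  obtain ⟨M, hM⟩ := Metric.tendsto_atTop.1 hε δ hδ
  refine ⟨M, fun m hm => ?_⟩
  have hεδ : ε m < δ := by
    have := hM m hm
    rwa [Real.dist_eq, sub_zero, abs_of_pos (hε0 m)] at this
  have hhat := (continuous_hat y (ε m)).continuousOn (s := uIcc 0 1)
  have e : (∫ z in (0 : ℝ)..1, f z * hat y (ε m) z) - f y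
      = ∫ z in (0 : ℝ)..1, (f z - f y) * hat y (ε m) z := by
    have i1 : IntervalIntegrable (fun z => f z * hat y (ε m) z) volume 0 1 :=
      (hf'.mul hhat).intervalIntegrable
    have i2 : IntervalIntegrable (fun z => f y * hat y (ε m) z) volume 0 1 :=
      (continuousOn_const.mul hhat).intervalIntegrable
    simp only [sub_mul]
    rw [intervalIntegral.integral_sub i1 i2, intervalIntegral.integral_const_mul,
      integral_hat (hε0 m) (h0 m) (h1 m), mul_one]
  rw [Real.dist_eq, e]
  have hle := intervalIntegral.norm_integral_le_of_norm_le (μ := volume) (a := (0 : ℝ)) (b := 1)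
    (f := fun z => (f z - f y) * hat y (ε m) z) (g := fun z => η / 2 * hat y (ε m) z)
    zero_le_one ?_ (continuousOn_const.mul hhat).intervalIntegrable
  · rw [intervalIntegral.integral_const_mul, integral_hat (hε0 m) (h0 m) (h1 m),
      Real.norm_eq_abs] at hle
    linarith
  · refine ae_of_all _ fun z hz => ?_
    rw [norm_mul, Real.norm_eq_abs (hat _ _ _), abs_of_nonneg (hat_nonneg (hε0 m) z)]
    by_cases hzy : ε m ≤ |z - y|
    · rw [hat_eq_zero (hε0 m) hzy]; simp
    · refine mul_le_mul_of_nonneg_right ?_ (hat_nonneg (hε0 m) z)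
      have := hδf z ⟨hz.1.le, hz.2⟩ (by rw [Real.dist_eq]; linarith)
      rw [Real.dist_eq] at this
      exact this.le

/-! ### Gaussianity of the solution field -/

/-- `√2 sin(π (k + 1) y)`, the eigenfunction of mode `k + 1` without the exponential weight. -/
def sinMode (k : ℕ) (y : ℝ) : ℝ := Real.sqrt 2 * Real.sin (Real.pi * (k + 1) * y)

/-- The solution field multiplied by the square root of the weight. -/
def weightedField {Ω : Type*} (θ : Fin 3 → ℝ) (X : ℝ → ℝ → Ω → ℝ) (t y : ℝ) (ω : Ω) : ℝ :=
  Real.exp (y * (θ 1 / (2 * θ 2))) * X t y ω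

/-- The covariance of the coordinate process of mode `k + 1` at time lag `h`. -/
def modeCov (θ : Fin 3 → ℝ) (σ : ℝ) (k : ℕ) (h : ℝ) : ℝ :=
  σ ^ 2 / (2 * eigenvalue θ (k + 1)) * Real.exp (-eigenvalue θ (k + 1) * h)

lemma sinMode_mul_sinMode (k : ℕ) (y z : ℝ) : sinMode k y * sinMode k z
    = 2 * Real.sin (Real.pi * (k + 1) * y) * Real.sin (Real.pi * (k + 1) * z) := by
  unfold sinMode
  have := Real.mul_self_sqrt (zero_le_two (α := ℝ))
  linear_combination (Real.sin (Real.pi * (k + 1) * y) * Real.sin (Real.pi * (k + 1) * z)) * this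

lemma abs_sinMode_le (k : ℕ) (y : ℝ) : |sinMode k y| ≤ Real.sqrt 2 := by
  rw [sinMode, abs_mul, abs_of_nonneg (Real.sqrt_nonneg 2)]
  exact mul_le_of_le_one_right (Real.sqrt_nonneg 2) (Real.abs_sin_le_one _)

/-- The constant is min(λ₁, π²θ₂). If the part of λ_k independent of k is nonnegative, it can be
dropped; if it is negative, multiplying it by (k+1)² only decreases it, which leaves λ₁(k+1)². The
bound by π²θ₂ later allows the same constant to minorize the purely quadratic spectrum. -/
lemma exists_eigenvalue_lower_bound {θ : Fin 3 → ℝ} (hθ : 0 < θ 2) (hpos : 0 < eigenvalue θ 1) :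
    ∃ c, 0 < c ∧ c ≤ Real.pi ^ 2 * θ 2 ∧ ∀ k : ℕ, c * (k + 1 : ℝ) ^ 2 ≤ eigenvalue θ (k + 1) := by
  have h2 : 0 < Real.pi ^ 2 * θ 2 := by positivity
  refine ⟨min (eigenvalue θ 1) (Real.pi ^ 2 * θ 2), lt_min hpos h2, min_le_right _ _,
    fun k => ?_⟩
  have hk : (1 : ℝ) ≤ (k + 1 : ℝ) ^ 2 := by
    have : (0 : ℝ) ≤ k := k.cast_nonneg
    nlinarith
  unfold eigenvalue
  push_cast
  set c := -θ 0 + θ 1 ^ 2 / (4 * θ 2)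
  rcases le_total 0 c with hc | hc
  · have := mul_le_mul_of_nonneg_right
      (min_le_right (c + Real.pi ^ 2 * (1 : ℝ) ^ 2 * θ 2) (Real.pi ^ 2 * θ 2))
      (by positivity : (0 : ℝ) ≤ (k + 1 : ℝ) ^ 2)
    nlinarith
  · have := mul_le_mul_of_nonneg_right
      (min_le_left (c + Real.pi ^ 2 * (1 : ℝ) ^ 2 * θ 2) (Real.pi ^ 2 * θ 2))
      (by positivity : (0 : ℝ) ≤ (k + 1 : ℝ) ^ 2)
    nlinarith

/-- Half of the weight is absorbed by the field and the other half cancels the exponential in the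
eigenfunction, so that only a sine coefficient remains. -/
lemma coord_eq_integral {Ω : Type*} (θ : Fin 3 → ℝ) (hθ : 0 < θ 2) (X : ℝ → ℝ → Ω → ℝ) (k : ℕ)
    (t : ℝ) (ω : Ω) : coord θ X (k + 1) t ω = Real.sqrt 2 *
      ∫ z in (0 : ℝ)..1, weightedField θ X t z ω * Real.sin (Real.pi * (k + 1) * z) := by
  rw [← intervalIntegral.integral_const_mul]
  unfold coord innerθ
  refine intervalIntegral.integral_congr fun z _ => ?_
  simp only [eigenfunction, weightedField]
  have : Real.exp (z * (θ 1 / (2 * θ 2)))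
      = Real.exp (z * θ 1 / θ 2) * Real.exp (-(θ 1 / (2 * θ 2)) * z) := by
    rw [← Real.exp_add]
    congr 1
    field_simp
    ring
  rw [this]
  push_cast
  ring

/-- Sine series of merely continuous paths need not converge pointwise, hence two limits. For fixed
widths the number of modes tends to infinity and yields the averages of the paths against hats; then
the widths tend to 0 and continuity recovers the point values. The variances follow because the mode
terms are O(k⁻²) uniformly in the widths. -/
lemma isCentredGaussian_field_sum {Ω : Type*} [MeasurableSpace Ω] {P : Measure Ω}
    [IsProbabilityMeasure P] {θ : Fin 3 → ℝ} (hθ : 0 < θ 2) (hpos : 0 < eigenvalue θ 1) {σ : ℝ}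
    {W : ℕ → ℝ≥0 → Ω → ℝ} {X : ℝ → ℝ → Ω → ℝ} (hX : IsStationarySolution P θ σ W X)
    {ι : Type*} [Fintype ι] {n : ℕ} (hn : 0 < n) (τ : ι → ℕ) (hτ : ∀ a, τ a ≤ n)
    (y : ι → ℝ) (hy : ∀ a, y a ∈ Ioo (0 : ℝ) 1) (c : ι → ℝ) :
    IsCentredGaussian P (fun ω => ∑ a, c a * weightedField θ X (τ a * mesh n) (y a) ω)
      (∑' k : ℕ, ∑ a, ∑ b, (c a * sinMode k (y a)) * (c b * sinMode k (y b))
        * modeCov θ σ k (|(τ a : ℝ) - τ b| * mesh n)) := by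
  obtain ⟨c₀, hc₀, -, hc₀l⟩ := exists_eigenvalue_lower_bound hθ hpos
  have hlam := eigenvalue_pos hθ hpos
  have hmesh := mesh_nonneg n
  -- The widths keep [y - ε, y + ε] inside [0, 1], as the sine expansion of the hat requires.
  set ε : ι → ℕ → ℝ := fun a m => min (y a) (1 - y a) / (m + 1) with hεdef
  have hεpos : ∀ a m, 0 < ε a m := fun a m =>
    div_pos (lt_min (hy a).1 (by linarith [(hy a).2])) (by positivity)
  have hεle : ∀ a m, ε a m ≤ min (y a) (1 - y a) := fun a m =>
    div_le_self (lt_min (hy a).1 (by linarith [(hy a).2])).le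
      (by linarith [m.cast_nonneg (α := ℝ)])
  have hε0 : ∀ a m, 0 ≤ y a - ε a m := fun a m => by
    linarith [hεle a m, min_le_left (y a) (1 - y a)]
  have hε1 : ∀ a m, y a + ε a m ≤ 1 := fun a m => by
    linarith [hεle a m, min_le_right (y a) (1 - y a)]
  have hεlim : ∀ a, Tendsto (ε a) atTop (𝓝 0) := fun a => by
    have := (tendsto_one_div_add_atTop_nhds_zero_nat (𝕜 := ℝ)).const_mul (min (y a) (1 - y a))
    simpa [hεdef, div_eq_mul_inv] using this
  set q : ℕ → ℕ → ℝ := fun m k => ∑ a, ∑ b, (c a * (hatMult (ε a m) k * sinMode k (y a)))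
    * (c b * (hatMult (ε b m) k * sinMode k (y b)))
    * modeCov θ σ k (|(τ a : ℝ) - τ b| * mesh n) with hq
  have hcont : ∀ᵐ ω ∂P, ∀ a, ContinuousOn (fun z => weightedField θ X (τ a * mesh n) z ω)
      (Icc 0 1) := by
    filter_upwards [hX.continuous] with ω hω a
    refine ContinuousOn.mul (by fun_prop) ?_
    refine hω.comp (f := fun z : ℝ => ((τ a * mesh n : ℝ), z)) (by fun_prop) fun z hz => ⟨?_, hz⟩
    refine ⟨by positivity, ?_⟩
    have : (τ a : ℝ) ≤ n := by exact_mod_cast hτ a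
    have hn' : (0 : ℝ) < n := by exact_mod_cast hn
    simpa [mesh, ← div_eq_mul_inv] using (div_le_one hn').2 this
  have hcov : ∀ k h, 0 ≤ h → |modeCov θ σ k h| ≤ σ ^ 2 / (2 * c₀) * (1 / (k + 1 : ℝ) ^ 2) := by
    intro k h hh
    have hl := hlam k
    have hb : (0 : ℝ) < c₀ * (k + 1) ^ 2 := by positivity
    unfold modeCov
    rw [abs_mul, Real.abs_exp, abs_of_nonneg (by positivity)]
    calc σ ^ 2 / (2 * eigenvalue θ (k + 1)) * Real.exp (-eigenvalue θ (k + 1) * h)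
        ≤ σ ^ 2 / (2 * eigenvalue θ (k + 1)) * 1 := by
          refine mul_le_mul_of_nonneg_left (Real.exp_le_one_iff.2 ?_) (by positivity)
          nlinarith
      _ ≤ σ ^ 2 / (2 * (c₀ * (k + 1) ^ 2)) := by
          rw [mul_one]
          exact div_le_div_of_nonneg_left (sq_nonneg _) (by positivity) (by linarith [hc₀l k])
      _ = _ := by rw [div_mul_div_comm]; ring
  set bound : ℕ → ℝ := fun k => (∑ a, ∑ b, (|c a| * Real.sqrt 2) * (|c b| * Real.sqrt 2))
    * (σ ^ 2 / (2 * c₀) * (1 / (k + 1 : ℝ) ^ 2)) with hbound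
  have hbs : Summable bound := (summable_one_div_succ_sq.mul_left _).mul_left _
  have hqb : ∀ m k, ‖q m k‖ ≤ bound k := by
    intro m k
    have hfac : ∀ a, |c a * (hatMult (ε a m) k * sinMode k (y a))| ≤ |c a| * Real.sqrt 2 := by
      intro a
      rw [abs_mul, abs_mul, abs_of_nonneg (hatMult_nonneg _ _)]
      refine mul_le_mul_of_nonneg_left ?_ (abs_nonneg _)
      calc _ ≤ 1 * Real.sqrt 2 := mul_le_mul (hatMult_le_one _ _) (abs_sinMode_le _ _)
            (abs_nonneg _) zero_le_one
        _ = _ := one_mul _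
    simp only [hq, hbound, Real.norm_eq_abs]
    rw [Finset.sum_mul]
    refine (Finset.abs_sum_le_sum_abs _ _).trans (Finset.sum_le_sum fun a _ => ?_)
    rw [Finset.sum_mul]
    refine (Finset.abs_sum_le_sum_abs _ _).trans (Finset.sum_le_sum fun b _ => ?_)
    rw [abs_mul, abs_mul]
    refine mul_le_mul (mul_le_mul (hfac a) (hfac b) (abs_nonneg _) (by positivity))
      (hcov k _ (by positivity)) (abs_nonneg _) (by positivity)
  have hZ : ∀ m, IsCentredGaussian P (fun ω => ∑ a, c a *
      ∫ z in (0 : ℝ)..1, weightedField θ X (τ a * mesh n) z ω * hat (y a) (ε a m) z)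
      (∑' k, q m k) := by
    intro m
    have hG := isCentredGaussian_coord_sum hθ hpos hX hn τ hτ
      (fun k a => c a * (hatMult (ε a m) k * sinMode k (y a)))
    refine IsCentredGaussian.of_tendsto hG ?_ ?_
    · filter_upwards [hcont] with ω hω
      have h1 : ∀ a, HasSum (fun k : ℕ => c a * (hatMult (ε a m) k * sinMode k (y a))
          * coord θ X (k + 1) (τ a * mesh n) ω) (c a *
          ∫ z in (0 : ℝ)..1, weightedField θ X (τ a * mesh n) z ω * hat (y a) (ε a m) z) := by
        intro a
        refine HasSum.of_eq ((hasSum_integral_hat (hω a) (hεpos a m) (hε0 a m)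
          (hε1 a m)).mul_left (c a)) (fun k => ?_) rfl
        rw [coord_eq_integral θ hθ, sinMode]
        have := Real.mul_self_sqrt (zero_le_two (α := ℝ))
        linear_combination (c a * hatMult (ε a m) k * Real.sin (Real.pi * (k + 1) * y a) *
          ∫ z in (0 : ℝ)..1, weightedField θ X (τ a * mesh n) z ω
            * Real.sin (Real.pi * (k + 1) * z)) * this
      exact (hasSum_sum fun a (_ : a ∈ Finset.univ) => h1 a).tendsto_sum_nat
    · exact (Summable.of_norm_bounded hbs (hqb m)).hasSum.tendsto_sum_nat
  refine IsCentredGaussian.of_tendsto hZ ?_ ?_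
  · filter_upwards [hcont] with ω hω
    refine tendsto_finsetSum _ fun a _ => Tendsto.const_mul _ ?_
    exact tendsto_integral_hat (hω a) (hεpos a) (hεlim a) (hε0 a) (hε1 a)
  · refine tendsto_tsum_of_dominated_convergence hbs (fun k => ?_) (Eventually.of_forall hqb)
    refine tendsto_finsetSum _ fun a _ => tendsto_finsetSum _ fun b _ => ?_
    have hl : ∀ a, Tendsto (fun m => c a * (hatMult (ε a m) k * sinMode k (y a))) atTop
        (𝓝 (c a * sinMode k (y a))) := fun a => by
      have := ((tendsto_hatMult k (fun m => (hεpos a m).ne') (hεlim a)).mul_const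
        (sinMode k (y a))).const_mul (c a)
      rwa [one_mul] at this
    exact ((hl a).mul (hl b)).mul_const _

/-! ### Covariances of the squared increments -/

/-- The normalized covariance at lag `r` of the increments of a stationary Ornstein-Uhlenbeck
process over unit time steps, as a function of its mean reversion `u`. -/
def lagFun : ℕ → ℝ → ℝ
  | 0, u => (1 - Real.exp (-u)) / u
  | r + 1, u => -(Real.exp (-(r * u)) * (1 - Real.exp (-u)) * ((1 - Real.exp (-u)) / u)) / 2

lemma one_sub_exp_neg_nonneg {u : ℝ} (hu : 0 ≤ u) : 0 ≤ 1 - Real.exp (-u) := by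
  linarith [Real.exp_le_one_iff.2 (neg_nonpos.2 hu)]

lemma one_sub_exp_neg_le_one (u : ℝ) : 1 - Real.exp (-u) ≤ 1 := by
  linarith [Real.exp_pos (-u)]

lemma one_sub_exp_neg_le (u : ℝ) : 1 - Real.exp (-u) ≤ u := by
  linarith [Real.add_one_le_exp (-u)]

lemma abs_lagFun_le_div (r : ℕ) {u : ℝ} (hu : 0 < u) :
    |lagFun r u| ≤ (1 - Real.exp (-u)) / u := by
  have h0 := one_sub_exp_neg_nonneg hu.le
  have h1 := one_sub_exp_neg_le_one u
  have h2 : 0 ≤ (1 - Real.exp (-u)) / u := div_nonneg h0 hu.le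
  cases r with
  | zero => exact (abs_of_nonneg h2).le
  | succ r =>
    have h3 : Real.exp (-(r * u)) ≤ 1 := Real.exp_le_one_iff.2 (by have := hu.le; simp; positivity)
    have h4 : 0 ≤ Real.exp (-(r * u)) * (1 - Real.exp (-u)) :=
      mul_nonneg (Real.exp_nonneg _) h0
    have h5 : Real.exp (-(r * u)) * (1 - Real.exp (-u)) ≤ 1 := mul_le_one₀ h3 h0 h1
    rw [lagFun, neg_div, abs_neg, abs_of_nonneg (by positivity)]
    nlinarith [mul_le_mul_of_nonneg_right h5 h2]

lemma abs_lagFun_le_inv (r : ℕ) {u : ℝ} (hu : 0 < u) : |lagFun r u| ≤ 1 / u :=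
  (abs_lagFun_le_div r hu).trans
    (div_le_div_of_nonneg_right (one_sub_exp_neg_le_one u) hu.le)

/-- The normalized covariance at lag `r` of the increments of the weighted field. -/
def incrCov (θ : Fin 3 → ℝ) (n r : ℕ) (y z : ℝ) : ℝ :=
  ∑' k : ℕ, sinMode k y * sinMode k z * lagFun r (eigenvalue θ (k + 1) * mesh n)

lemma mesh_pos {n : ℕ} (hn : 0 < n) : 0 < mesh n := by
  unfold mesh
  positivity

lemma summable_lagFun {θ : Fin 3 → ℝ} (hθ : 0 < θ 2) (hpos : 0 < eigenvalue θ 1) {n : ℕ}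
    (hn : 0 < n) (r : ℕ) :
    Summable fun k : ℕ => |lagFun r (eigenvalue θ (k + 1) * mesh n)| := by
  obtain ⟨c, hc, -, hcl⟩ := exists_eigenvalue_lower_bound hθ hpos
  have hm := mesh_pos hn
  refine Summable.of_nonneg_of_le (fun k => abs_nonneg _) (fun k => ?_)
    (summable_one_div_succ_sq.mul_left (1 / (c * mesh n)))
  refine (abs_lagFun_le_inv r (mul_pos (eigenvalue_pos hθ hpos k) hm)).trans ?_
  rw [one_div_mul_one_div]
  refine one_div_le_one_div_of_le (by positivity) ?_
  calc c * mesh n * (k + 1 : ℝ) ^ 2 = c * (k + 1 : ℝ) ^ 2 * mesh n := by ring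
    _ ≤ _ := mul_le_mul_of_nonneg_right (hcl k) hm.le

lemma summable_incrCov {θ : Fin 3 → ℝ} (hθ : 0 < θ 2) (hpos : 0 < eigenvalue θ 1) {n : ℕ}
    (hn : 0 < n) (r : ℕ) (y z : ℝ) : Summable fun k : ℕ =>
      sinMode k y * sinMode k z * lagFun r (eigenvalue θ (k + 1) * mesh n) := by
  refine Summable.of_norm_bounded ((summable_lagFun hθ hpos hn r).mul_left 2) fun k => ?_
  rw [Real.norm_eq_abs, abs_mul, abs_mul]
  refine mul_le_mul_of_nonneg_right ?_ (abs_nonneg _)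
  calc |sinMode k y| * |sinMode k z| ≤ Real.sqrt 2 * Real.sqrt 2 :=
        mul_le_mul (abs_sinMode_le _ _) (abs_sinMode_le _ _) (abs_nonneg _) (Real.sqrt_nonneg _)
    _ = 2 := Real.mul_self_sqrt zero_le_two

/-- The covariance of two increments is a second difference of e^(-λ|h|). The kink of |h| at 0 is
why lag 0 has a formula of its own. -/
lemma modeCov_second_difference {θ : Fin 3 → ℝ} (σ : ℝ) {k n : ℕ}
    (hlam : 0 < eigenvalue θ (k + 1)) (hn : 0 < n) (i j : ℕ) :
    modeCov θ σ k (|((i + 1 : ℕ) : ℝ) - ((j + 1 : ℕ) : ℝ)| * mesh n)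
      - modeCov θ σ k (|((i + 1 : ℕ) : ℝ) - (j : ℝ)| * mesh n)
      - modeCov θ σ k (|(i : ℝ) - ((j + 1 : ℕ) : ℝ)| * mesh n)
      + modeCov θ σ k (|(i : ℝ) - (j : ℝ)| * mesh n)
      = σ ^ 2 * mesh n * lagFun (Nat.dist i j) (eigenvalue θ (k + 1) * mesh n) := by
  have hm := mesh_pos hn
  wlog hij : j ≤ i generalizing i j
  · have := this j i (le_of_not_ge hij)
    rw [Nat.dist_comm, ← this, abs_sub_comm ((i + 1 : ℕ) : ℝ) ((j + 1 : ℕ) : ℝ),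
      abs_sub_comm ((i + 1 : ℕ) : ℝ) (j : ℝ), abs_sub_comm (i : ℝ) ((j + 1 : ℕ) : ℝ),
      abs_sub_comm (i : ℝ) (j : ℝ)]
    ring
  obtain ⟨r, rfl⟩ := Nat.exists_eq_add_of_le hij
  rw [Nat.dist_comm, Nat.dist_eq_sub_of_le hij, Nat.add_sub_cancel_left]
  set lam := eigenvalue θ (k + 1) with hlamdef
  cases r with
  | zero =>
    simp only [modeCov, lagFun, Nat.add_zero, sub_self, abs_zero, zero_mul, mul_zero,
      Real.exp_zero, ← hlamdef]
    push_cast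
    rw [show (j : ℝ) + 1 - j = 1 by ring, show (j : ℝ) - (j + 1) = -1 by ring, abs_neg, abs_one,
      one_mul, neg_mul]
    field_simp
    ring
  | succ r =>
    have e1 : |((j + (r + 1) + 1 : ℕ) : ℝ) - ((j + 1 : ℕ) : ℝ)| = r + 1 := by
      push_cast
      rw [show (j : ℝ) + (r + 1) + 1 - (j + 1) = r + 1 by ring, abs_of_nonneg (by positivity)]
    have e2 : |((j + (r + 1) + 1 : ℕ) : ℝ) - (j : ℝ)| = r + 2 := by
      push_cast
      rw [show (j : ℝ) + (r + 1) + 1 - j = r + 2 by ring, abs_of_nonneg (by positivity)]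
    have e3 : |((j + (r + 1) : ℕ) : ℝ) - ((j + 1 : ℕ) : ℝ)| = r := by
      push_cast
      rw [show (j : ℝ) + (r + 1) - (j + 1) = r by ring, abs_of_nonneg (by positivity)]
    have e4 : |((j + (r + 1) : ℕ) : ℝ) - (j : ℝ)| = r + 1 := by
      push_cast
      rw [show (j : ℝ) + (r + 1) - j = r + 1 by ring, abs_of_nonneg (by positivity)]
    rw [e1, e2, e3, e4]
    simp only [modeCov, lagFun, ← hlamdef]
    have x1 : Real.exp (-lam * ((r + 1 : ℝ) * mesh n))
        = Real.exp (-(r * (lam * mesh n))) * Real.exp (-(lam * mesh n)) := by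
      rw [← Real.exp_add]; congr 1; ring
    have x2 : Real.exp (-lam * ((r + 2 : ℝ) * mesh n))
        = Real.exp (-(r * (lam * mesh n))) * Real.exp (-(lam * mesh n)) ^ 2 := by
      rw [sq, ← Real.exp_add, ← Real.exp_add]; congr 1; ring
    have x3 : Real.exp (-lam * ((r : ℝ) * mesh n)) = Real.exp (-(r * (lam * mesh n))) := by
      congr 1; ring
    rw [x1, x2, x3]
    field_simp
    ring

/-- The `i + 1`-st increment of the weighted field. -/
def weightedIncr {Ω : Type*} (θ : Fin 3 → ℝ) (X : ℝ → ℝ → Ω → ℝ) (n i : ℕ) (y : ℝ) (ω : Ω) : ℝ :=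
  weightedField θ X ((i + 1 : ℕ) * mesh n) y ω - weightedField θ X (i * mesh n) y ω

lemma realizedVol_eq {Ω : Type*} {θ : Fin 3 → ℝ} (hθ : 0 < θ 2) (X : ℝ → ℝ → Ω → ℝ) (p n : ℕ) (y : ℝ) :
    realizedVol θ X p n y = fun ω => 1 / (p * Real.sqrt (mesh n)) *
      ∑ i ∈ Finset.range p, weightedIncr θ X n i y ω ^ 2 := by
  ext ω
  unfold realizedVol
  congr 1
  have key : ∀ i : ℕ, increment X n (i + 1) y ω ^ 2 * Real.exp (y * θ 1 / θ 2)
      = weightedIncr θ X n i y ω ^ 2 := by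
    intro i
    have he : Real.exp (y * θ 1 / θ 2) = Real.exp (y * (θ 1 / (2 * θ 2))) ^ 2 := by
      rw [← Real.exp_nat_mul]
      congr 1
      push_cast
      field_simp
    unfold increment weightedIncr weightedField
    rw [he]
    push_cast
    rw [show (i : ℝ) + 1 - 1 = i by ring]
    ring
  induction p with
  | zero => simp
  | succ p ih => rw [Finset.sum_Icc_succ_top (by omega), ih, Finset.sum_range_succ, key]

section

variable {Ω : Type*} [MeasurableSpace Ω] {P : Measure Ω} [IsProbabilityMeasure P] {θ : Fin 3 → ℝ}
  {σ : ℝ} {W : ℕ → ℝ≥0 → Ω → ℝ} {X : ℝ → ℝ → Ω → ℝ}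

/-- Four point values with coefficients 1, -1, s, -s. The value s = 0 gives the law of one
increment, and s = ±1 gives the sum and the difference that `IsCentredGaussian.covariance_sq`
requires. -/
lemma isCentredGaussian_incr_add (hθ : 0 < θ 2) (hpos : 0 < eigenvalue θ 1)
    (hX : IsStationarySolution P θ σ W X) {n : ℕ} {i j : ℕ} (hi : i < n) (hj : j < n)
    {y z : ℝ} (hy : y ∈ Ioo (0 : ℝ) 1) (hz : z ∈ Ioo (0 : ℝ) 1) (s : ℝ) :
    IsCentredGaussian P (fun ω => weightedIncr θ X n i y ω + s * weightedIncr θ X n j z ω)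
      (σ ^ 2 * mesh n * incrCov θ n 0 y y + s ^ 2 * (σ ^ 2 * mesh n * incrCov θ n 0 z z)
        + 2 * (s * (σ ^ 2 * mesh n * incrCov θ n (Nat.dist i j) y z))) := by
  have hn : 0 < n := by omega
  have h := isCentredGaussian_field_sum hθ hpos hX hn ![i + 1, i, j + 1, j]
    (by intro a; fin_cases a <;> simp <;> omega) ![y, y, z, z]
    (by intro a; fin_cases a <;> simp <;> first | exact hy | exact hz) ![1, -1, s, -s]
  have hv : ∀ k : ℕ, (∑ a, ∑ b, ((![1, -1, s, -s] : Fin 4 → ℝ) a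
        * sinMode k ((![y, y, z, z] : Fin 4 → ℝ) a))
        * ((![1, -1, s, -s] : Fin 4 → ℝ) b * sinMode k ((![y, y, z, z] : Fin 4 → ℝ) b))
        * modeCov θ σ k (|((![i + 1, i, j + 1, j] : Fin 4 → ℕ) a : ℝ)
          - ((![i + 1, i, j + 1, j] : Fin 4 → ℕ) b : ℝ)| * mesh n))
      = (σ ^ 2 * mesh n * (sinMode k y * sinMode k y * lagFun 0 (eigenvalue θ (k + 1) * mesh n))
        + s ^ 2 * (σ ^ 2 * mesh n *
          (sinMode k z * sinMode k z * lagFun 0 (eigenvalue θ (k + 1) * mesh n))))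
        + 2 * (s * (σ ^ 2 * mesh n * (sinMode k y * sinMode k z
          * lagFun (Nat.dist i j) (eigenvalue θ (k + 1) * mesh n)))) := by
    intro k
    have hl := eigenvalue_pos hθ hpos k
    have k1 := modeCov_second_difference σ hl hn i i
    have k2 := modeCov_second_difference σ hl hn j j
    have k3 := modeCov_second_difference σ hl hn i j
    have k4 := modeCov_second_difference σ hl hn j i
    rw [Nat.dist_self] at k1 k2
    rw [Nat.dist_comm] at k4
    simp only [Fin.sum_univ_four, Matrix.cons_val_zero, Matrix.cons_val_one, Matrix.cons_val]
    linear_combination (sinMode k y * sinMode k y) * k1 + (s ^ 2 * sinMode k z * sinMode k z) * k2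
      + (s * sinMode k y * sinMode k z) * (k3 + k4)
  rw [tsum_congr hv] at h
  have s1 := (summable_incrCov hθ hpos hn 0 y y).mul_left (σ ^ 2 * mesh n)
  have s2 := ((summable_incrCov hθ hpos hn 0 z z).mul_left (σ ^ 2 * mesh n)).mul_left (s ^ 2)
  have s3 := (((summable_incrCov hθ hpos hn (Nat.dist i j) y z).mul_left
    (σ ^ 2 * mesh n)).mul_left s).mul_left 2
  rw [(s1.add s2).tsum_add s3, s1.tsum_add s2, tsum_mul_left, tsum_mul_left, tsum_mul_left,
    tsum_mul_left, tsum_mul_left, tsum_mul_left] at h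
  refine h.congr (ae_of_all _ fun ω => ?_)
  simp only [Fin.sum_univ_four, Matrix.cons_val_zero, Matrix.cons_val_one, Matrix.cons_val,
    weightedIncr]
  ring

lemma isCentredGaussian_incr (hθ : 0 < θ 2) (hpos : 0 < eigenvalue θ 1)
    (hX : IsStationarySolution P θ σ W X) {n : ℕ} {i : ℕ} (hi : i < n)
    {y : ℝ} (hy : y ∈ Ioo (0 : ℝ) 1) :
    IsCentredGaussian P (fun ω => weightedIncr θ X n i y ω)
      (σ ^ 2 * mesh n * incrCov θ n 0 y y) := by
  simpa using isCentredGaussian_incr_add hθ hpos hX hi hi hy hy 0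

lemma covariance_incr_sq (hθ : 0 < θ 2) (hpos : 0 < eigenvalue θ 1)
    (hX : IsStationarySolution P θ σ W X) {n : ℕ} {i j : ℕ} (hi : i < n) (hj : j < n)
    {y z : ℝ} (hy : y ∈ Ioo (0 : ℝ) 1) (hz : z ∈ Ioo (0 : ℝ) 1) :
    cov[fun ω => weightedIncr θ X n i y ω ^ 2, fun ω => weightedIncr θ X n j z ω ^ 2; P]
      = 2 * (σ ^ 2 * mesh n * incrCov θ n (Nat.dist i j) y z) ^ 2 := by
  have h1 := isCentredGaussian_incr_add hθ hpos hX hi hj hy hz 1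
  have h2 := isCentredGaussian_incr_add hθ hpos hX hi hj hy hz (-1)
  refine IsCentredGaussian.covariance_sq (isCentredGaussian_incr hθ hpos hX hi hy)
    (isCentredGaussian_incr hθ hpos hX hj hz) ?_ ?_
  · simpa using h1
  · simpa [← sub_eq_add_neg] using h2

lemma memLp_realizedVol (hθ : 0 < θ 2) (hpos : 0 < eigenvalue θ 1)
    (hX : IsStationarySolution P θ σ W X) {n p : ℕ} (hp : p ≤ n)
    {y : ℝ} (hy : y ∈ Ioo (0 : ℝ) 1) : MemLp (realizedVol θ X p n y) 2 P := by
  rw [realizedVol_eq hθ]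
  refine MemLp.const_mul ?_ _
  exact memLp_finsetSum _ fun i hi => (isCentredGaussian_incr hθ hpos hX
    ((Finset.mem_range.1 hi).trans_le hp) hy).memLp_sq

lemma covariance_realizedVol (hθ : 0 < θ 2) (hpos : 0 < eigenvalue θ 1)
    (hX : IsStationarySolution P θ σ W X) {n p : ℕ} (hp0 : 0 < p) (hp : p ≤ n)
    {y z : ℝ} (hy : y ∈ Ioo (0 : ℝ) 1) (hz : z ∈ Ioo (0 : ℝ) 1) :
    cov[realizedVol θ X p n y, realizedVol θ X p n z; P]
      = 2 * σ ^ 4 * mesh n / (p : ℝ) ^ 2 * ∑ i ∈ Finset.range p, ∑ j ∈ Finset.range p,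
        incrCov θ n (Nat.dist i j) y z ^ 2 := by
  have hm := mesh_pos (hp0.trans_le hp)
  rw [realizedVol_eq hθ, realizedVol_eq hθ, covariance_const_mul_left, covariance_const_mul_right,
    covariance_fun_sum_fun_sum']
  · have e : ∀ i ∈ Finset.range p, ∀ j ∈ Finset.range p,
        cov[fun ω => weightedIncr θ X n i y ω ^ 2, fun ω => weightedIncr θ X n j z ω ^ 2; P]
        = 2 * σ ^ 4 * mesh n ^ 2 * incrCov θ n (Nat.dist i j) y z ^ 2 := fun i hi j hj => by
      rw [covariance_incr_sq hθ hpos hX ((Finset.mem_range.1 hi).trans_le hp)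
        ((Finset.mem_range.1 hj).trans_le hp) hy hz]
      ring
    rw [Finset.sum_congr rfl fun i hi => Finset.sum_congr rfl (e i hi)]
    simp only [← Finset.mul_sum]
    have hs : Real.sqrt (mesh n) ^ 2 = mesh n := Real.sq_sqrt hm.le
    have hs0 : 0 < Real.sqrt (mesh n) := Real.sqrt_pos.2 hm
    have hp' : (0 : ℝ) < p := by exact_mod_cast hp0
    field_simp
    rw [hs]
    ring
  · exact fun i hi => (isCentredGaussian_incr hθ hpos hX
      ((Finset.mem_range.1 hi).trans_le hp) hy).memLp_sq
  · exact fun i hi => (isCentredGaussian_incr hθ hpos hX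
      ((Finset.mem_range.1 hi).trans_le hp) hz).memLp_sq

end

/-! ### Variation of the lag functions -/

/-- The quotient is the slope of a chord of the convex function exp between -u and 0. -/
lemma div_one_sub_exp_antitone {u v : ℝ} (hu : 0 < u) (huv : u ≤ v) :
    (1 - Real.exp (-v)) / v ≤ (1 - Real.exp (-u)) / u := by
  have hv : 0 < v := hu.trans_le huv
  rw [div_le_div_iff₀ hv hu]
  have h := convexOn_exp.2 (mem_univ (0 : ℝ)) (mem_univ (-v))
    (show (0 : ℝ) ≤ 1 - u / v by rw [sub_nonneg, div_le_one hv]; exact huv)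
    (show (0 : ℝ) ≤ u / v by positivity) (by ring)
  simp only [smul_eq_mul, mul_zero, zero_add, Real.exp_zero, mul_one] at h
  rw [show u / v * -v = -u by field_simp] at h
  have h2 := mul_le_mul_of_nonneg_left h hv.le
  rw [show v * (1 - u / v + u / v * Real.exp (-v)) = v - u + u * Real.exp (-v) by
    field_simp] at h2
  linarith

lemma div_one_sub_exp_le_one {u : ℝ} (hu : 0 < u) : (1 - Real.exp (-u)) / u ≤ 1 :=
  (div_le_one hu).2 (one_sub_exp_neg_le u)

lemma div_one_sub_exp_nonneg {u : ℝ} (hu : 0 < u) : 0 ≤ (1 - Real.exp (-u)) / u :=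
  div_nonneg (one_sub_exp_neg_nonneg hu.le) hu.le

/-- A monotone bounded function whose increments dominate those of `lagFun r`. -/
def lagMaj (r : ℕ) (u : ℝ) : ℝ :=
  (1 - Real.exp (-u)) - Real.exp (-((r - 1 : ℕ) * u)) - (1 - Real.exp (-u)) / u

lemma exp_neg_nat_mul_le_one (r : ℕ) {u : ℝ} (hu : 0 ≤ u) : Real.exp (-(r * u)) ≤ 1 :=
  Real.exp_le_one_iff.2 (neg_nonpos.2 (mul_nonneg r.cast_nonneg hu))

lemma lagMaj_le (r : ℕ) {u : ℝ} (hu : 0 < u) : lagMaj r u ≤ 1 := by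
  unfold lagMaj
  linarith [one_sub_exp_neg_le_one u, Real.exp_pos (-((r - 1 : ℕ) * u)), div_one_sub_exp_nonneg hu]

lemma le_lagMaj (r : ℕ) {u : ℝ} (hu : 0 < u) : -2 ≤ lagMaj r u := by
  unfold lagMaj
  linarith [one_sub_exp_neg_nonneg hu.le, exp_neg_nat_mul_le_one (r - 1) hu.le,
    div_one_sub_exp_le_one hu]

lemma exp_neg_nat_mul_antitone (r : ℕ) {u v : ℝ} (huv : u ≤ v) :
    Real.exp (-(r * v)) ≤ Real.exp (-(r * u)) :=
  Real.exp_le_exp.2 (neg_le_neg (mul_le_mul_of_nonneg_left huv r.cast_nonneg))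

lemma exp_neg_antitone {u v : ℝ} (huv : u ≤ v) : Real.exp (-v) ≤ Real.exp (-u) :=
  Real.exp_le_exp.2 (neg_le_neg huv)

lemma abs_mul_mul_sub_le {a b c a' b' c' : ℝ} (ha0 : 0 ≤ a) (ha1 : a ≤ 1) (hb0 : 0 ≤ b)
    (hb1 : b ≤ 1) (hb0' : 0 ≤ b') (hb1' : b' ≤ 1) (hc0' : 0 ≤ c') (hc1' : c' ≤ 1) :
    |a * b * c - a' * b' * c'| ≤ |a - a'| + |b - b'| + |c - c'| := by
  have e : a * b * c - a' * b' * c'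
      = (b' * c') * (a - a') + (a * c') * (b - b') + (a * b) * (c - c') := by ring
  rw [e]
  have key : ∀ {t s : ℝ}, 0 ≤ t → t ≤ 1 → |t * s| ≤ |s| := fun {t s} h0 h1 => by
    rw [abs_mul, abs_of_nonneg h0]
    exact mul_le_of_le_one_left (abs_nonneg _) h1
  refine (abs_add_three _ _ _).trans (add_le_add (add_le_add ?_ ?_) ?_)
  · exact key (mul_nonneg hb0' hc0') (mul_le_one₀ hb1' hc0' hc1')
  · exact key (mul_nonneg ha0 hc0') (mul_le_one₀ ha1 hc0' hc1')
  · exact key (mul_nonneg ha0 hb0) (mul_le_one₀ ha1 hb0 hb1)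

/-- For r ≥ 1 the lag function is, up to the factor -1/2, a product of three monotone factors with
values in [0, 1], so its increment is at most the sum of theirs; `lagMaj` adds the factors with
signs that make each one increasing. For r = 0 the truncated `r - 1` makes the extra exponential
constant. -/
lemma abs_lagFun_sub_le (r : ℕ) {u v : ℝ} (hu : 0 < u) (huv : u ≤ v) :
    |lagFun r v - lagFun r u| ≤ lagMaj r v - lagMaj r u := by
  have hv : 0 < v := hu.trans_le huv
  have h1 := div_one_sub_exp_antitone hu huv
  have h2 := exp_neg_antitone huv
  cases r with
  | zero =>
    simp only [lagFun, lagMaj]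
    rw [abs_of_nonpos (by linarith)]
    simp only [Nat.zero_sub, Nat.cast_zero, zero_mul, neg_zero]
    linarith
  | succ r =>
    have h3 := exp_neg_nat_mul_antitone r huv
    have key := abs_mul_mul_sub_le (a := Real.exp (-(r * v))) (b := 1 - Real.exp (-v))
      (c := (1 - Real.exp (-v)) / v) (a' := Real.exp (-(r * u))) (b' := 1 - Real.exp (-u))
      (c' := (1 - Real.exp (-u)) / u) (Real.exp_nonneg _) (exp_neg_nat_mul_le_one r hv.le)
      (one_sub_exp_neg_nonneg hv.le) (one_sub_exp_neg_le_one v) (one_sub_exp_neg_nonneg hu.le)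
      (one_sub_exp_neg_le_one u) (div_one_sub_exp_nonneg hu) (div_one_sub_exp_le_one hu)
    rw [abs_of_nonpos (sub_nonpos.2 h3), abs_of_nonneg (a := 1 - Real.exp (-v) - _) (by linarith),
      abs_of_nonpos (sub_nonpos.2 h1)] at key
    simp only [lagFun, lagMaj, Nat.add_sub_cancel]
    rw [← sub_div, abs_div, abs_two, neg_sub_neg, abs_sub_comm]
    have := abs_nonneg (Real.exp (-(r * v)) * (1 - Real.exp (-v)) * ((1 - Real.exp (-v)) / v)
      - Real.exp (-(r * u)) * (1 - Real.exp (-u)) * ((1 - Real.exp (-u)) / u))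
    linarith

/-- The bound is uniform in r because x e^(-x) ≤ 1 at x = ru. -/
lemma exp_neg_nat_mul_sub_le (r : ℕ) {u v : ℝ} (hu : 0 < u) (huv : u ≤ v) :
    Real.exp (-(r * u)) - Real.exp (-(r * v)) ≤ (v - u) / u := by
  have e : Real.exp (-(r * v)) = Real.exp (-(r * u)) * Real.exp (-(r * (v - u))) := by
    rw [← Real.exp_add]; congr 1; ring
  have h1 : 1 - Real.exp (-(r * (v - u))) ≤ r * (v - u) := one_sub_exp_neg_le _
  have h2 : (r * u) * Real.exp (-(r * u)) ≤ 1 := by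
    have := Real.add_one_le_exp (r * u)
    rw [Real.exp_neg, ← div_eq_mul_inv, div_le_one (Real.exp_pos _)]
    linarith
  rw [le_div_iff₀ hu, e]
  calc (Real.exp (-(r * u)) - Real.exp (-(r * u)) * Real.exp (-(r * (v - u)))) * u
      = Real.exp (-(r * u)) * u * (1 - Real.exp (-(r * (v - u)))) := by ring
    _ ≤ Real.exp (-(r * u)) * u * (r * (v - u)) :=
        mul_le_mul_of_nonneg_left h1 (mul_nonneg (Real.exp_nonneg _) hu.le)
    _ = ((r * u) * Real.exp (-(r * u))) * (v - u) := by ring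
    _ ≤ 1 * (v - u) := mul_le_mul_of_nonneg_right h2 (sub_nonneg.2 huv)
    _ = v - u := one_mul _

/-- This relative estimate is what allows λ_kΔ to be replaced by π²k²θ₂Δ: the two differ relatively
by O(k⁻²), uniformly in Δ. -/
lemma lagMaj_sub_le (r : ℕ) {u v : ℝ} (hu : 0 < u) (huv : u ≤ v) :
    lagMaj r v - lagMaj r u ≤ 3 * ((v - u) / u) := by
  have hv : 0 < v := hu.trans_le huv
  have h1 := exp_neg_nat_mul_sub_le (r - 1) hu huv
  have h2 := exp_neg_nat_mul_sub_le 1 hu huv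
  simp only [Nat.cast_one, one_mul] at h2
  have h3 : (1 - Real.exp (-u)) / u - (1 - Real.exp (-v)) / v ≤ (v - u) / u := by
    have a : (1 - Real.exp (-u)) / v ≤ (1 - Real.exp (-v)) / v :=
      div_le_div_of_nonneg_right (by linarith [exp_neg_antitone huv]) hv.le
    have b : (1 - Real.exp (-u)) / u - (1 - Real.exp (-u)) / v
        = (1 - Real.exp (-u)) / u * ((v - u) / v) := by
      field_simp
    have c : (1 - Real.exp (-u)) / u * ((v - u) / v) ≤ 1 * ((v - u) / u) :=
      mul_le_mul (div_one_sub_exp_le_one hu)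
        (div_le_div_of_nonneg_left (by linarith) hu huv)
        (div_nonneg (by linarith) hv.le) zero_le_one
    linarith
  unfold lagMaj
  linarith

lemma abs_lagFun_sub_le_min (r : ℕ) {u v c : ℝ} (hc : 0 < c) (hu : c ≤ u) (hv : c ≤ v) :
    |lagFun r u - lagFun r v| ≤ 3 * (|u - v| / c) := by
  wlog huv : v ≤ u generalizing u v
  · rw [abs_sub_comm, abs_sub_comm u]
    exact this hv hu (le_of_not_ge huv)
  have hv0 := hc.trans_le hv
  refine (abs_lagFun_sub_le r hv0 huv).trans ((lagMaj_sub_le r hv0 huv).trans ?_)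
  rw [abs_of_nonneg (sub_nonneg.2 huv)]
  have := div_le_div_of_nonneg_left (sub_nonneg.2 huv) hc hv
  linarith

lemma abs_lagFun_le_one (r : ℕ) {u : ℝ} (hu : 0 < u) : |lagFun r u| ≤ 1 :=
  (abs_lagFun_le_div r hu).trans (div_one_sub_exp_le_one hu)

/-! ### Trigonometric sums -/

/-- Abel summation. The boundary term contributes D, and the variation of b is at most the total
increase of h, hence at most 3, which contributes 3D. -/
lemma abs_sum_mul_le {c b h : ℕ → ℝ} {D : ℝ} (hD : ∀ N, |∑ k ∈ Finset.range N, c k| ≤ D)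
    (hb : ∀ k, |b k| ≤ 1) (hbh : ∀ k, |b (k + 1) - b k| ≤ h (k + 1) - h k)
    (hh : ∀ k, h k ≤ 1) (hh' : ∀ k, -2 ≤ h k) (N : ℕ) :
    |∑ k ∈ Finset.range N, c k * b k| ≤ 4 * D := by
  have hD0 : 0 ≤ D := (abs_nonneg _).trans (hD 0)
  have e := sum_mul_sub_eq b (fun N => ∑ k ∈ Finset.range N, c k) N
  simp only [Finset.sum_range_succ, add_sub_cancel_left, Finset.sum_range_zero, mul_zero,
    sub_zero] at e
  simp only [← Finset.sum_range_succ] at e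
  rw [Finset.sum_congr rfl fun k _ => mul_comm (c k) (b k), e]
  have h1 : |b N * ∑ k ∈ Finset.range N, c k| ≤ 1 * D := by
    rw [abs_mul]
    exact mul_le_mul (hb N) (hD N) (abs_nonneg _) zero_le_one
  have h2 : |∑ k ∈ Finset.range N, (b (k + 1) - b k) * ∑ j ∈ Finset.range (k + 1), c j|
      ≤ 3 * D := by
    calc _ ≤ ∑ k ∈ Finset.range N, (h (k + 1) - h k) * D := by
          refine (Finset.abs_sum_le_sum_abs _ _).trans (Finset.sum_le_sum fun k _ => ?_)
          rw [abs_mul]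
          exact mul_le_mul (hbh k) (hD _) (abs_nonneg _) ((abs_nonneg _).trans (hbh k))
      _ = (h N - h 0) * D := by rw [← Finset.sum_mul, Finset.sum_range_sub]
      _ ≤ 3 * D := mul_le_mul_of_nonneg_right (by linarith [hh N, hh' 0]) hD0
  have := abs_sub (b N * ∑ k ∈ Finset.range N, c k)
    (∑ k ∈ Finset.range N, (b (k + 1) - b k) * ∑ j ∈ Finset.range (k + 1), c j)
  linarith

/-- Dirichlet kernel: multiplication by 2 sin(πz/2) makes the sum telescope. -/
lemma abs_sum_cos_le {z : ℝ} (hz : Real.sin (Real.pi * z / 2) ≠ 0) (N : ℕ) :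
    |∑ k ∈ Finset.range N, Real.cos (Real.pi * (k + 1) * z)|
      ≤ 1 / |Real.sin (Real.pi * z / 2)| := by
  have hs : 0 < |Real.sin (Real.pi * z / 2)| := abs_pos.2 hz
  have e : 2 * Real.sin (Real.pi * z / 2) * ∑ k ∈ Finset.range N, Real.cos (Real.pi * (k + 1) * z)
      = Real.sin (Real.pi * (N + 1 / 2) * z) - Real.sin (Real.pi * z / 2) := by
    have hk : ∀ k : ℕ, 2 * Real.sin (Real.pi * z / 2) * Real.cos (Real.pi * (k + 1) * z)
        = Real.sin (Real.pi * ((k + 1 : ℕ) + 1 / 2) * z)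
          - Real.sin (Real.pi * ((k : ℕ) + 1 / 2) * z) := by
      intro k
      push_cast
      rw [show Real.pi * ((k : ℝ) + 1 + 1 / 2) * z = Real.pi * (k + 1) * z + Real.pi * z / 2 by
        ring, show Real.pi * ((k : ℝ) + 1 / 2) * z = Real.pi * (k + 1) * z - Real.pi * z / 2 by
        ring, Real.sin_add, Real.sin_sub]
      ring
    rw [Finset.mul_sum, Finset.sum_congr rfl fun k _ => hk k,
      Finset.sum_range_sub (fun k : ℕ => Real.sin (Real.pi * (k + 1 / 2) * z))]
    congr 2
    push_cast
    ring
  rw [le_div_iff₀ hs]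
  have h2 : |2 * Real.sin (Real.pi * z / 2)
      * ∑ k ∈ Finset.range N, Real.cos (Real.pi * (k + 1) * z)| ≤ 2 := by
    rw [e]
    refine (abs_sub _ _).trans ?_
    linarith [Real.abs_sin_le_one (Real.pi * (N + 1 / 2) * z),
      Real.abs_sin_le_one (Real.pi * z / 2)]
  rw [abs_mul, abs_mul, abs_two] at h2
  linarith

/-! ### Sums over the modes and their integral approximation -/

lemma integrableOn_Ioi_of_bound {f : ℝ → ℝ} (hf : ContinuousOn f (Ioi 0)) {A B : ℝ}
    (hA : ∀ x ∈ Ioi (0 : ℝ), |f x| ≤ A) (hB : ∀ x ∈ Ioi (0 : ℝ), |f x| ≤ B * x ^ (-2 : ℝ)) :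
    IntegrableOn f (Ioi 0) := by
  rw [← Ioc_union_Ioi_eq_Ioi zero_le_one]
  refine IntegrableOn.union ?_ ?_
  · refine Integrable.mono' (g := fun _ => A) (integrableOn_const (by simp)) ?_ ?_
    · exact (hf.mono Ioc_subset_Ioi_self).aestronglyMeasurable measurableSet_Ioc
    · exact (ae_restrict_iff' measurableSet_Ioc).2 (ae_of_all _ fun x hx => hA x hx.1)
  · refine Integrable.mono' (g := fun x => B * x ^ (-2 : ℝ))
      ((integrableOn_Ioi_rpow_of_lt (by norm_num) zero_lt_one).const_mul B) ?_ ?_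
    · exact (hf.mono (Ioi_subset_Ioi zero_le_one)).aestronglyMeasurable measurableSet_Ioi
    · exact (ae_restrict_iff' measurableSet_Ioi).2
        (ae_of_all _ fun x hx => hB x (mem_Ioi.2 (lt_trans zero_lt_one (mem_Ioi.1 hx))))

lemma rpow_neg_two {x : ℝ} (hx : 0 < x) : x ^ (-2 : ℝ) = 1 / x ^ 2 := by
  rw [Real.rpow_neg hx.le, one_div, ← Real.rpow_natCast]
  norm_num

lemma integrableOn_one_sub_exp_div_sq {a : ℝ} (ha : 0 ≤ a) :
    IntegrableOn (fun x : ℝ => (1 - Real.exp (-(a * x ^ 2))) / x ^ 2) (Ioi 0) := by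
  refine integrableOn_Ioi_of_bound (A := a) (B := 1) ?_ ?_ ?_
  · exact ContinuousOn.div (by fun_prop) (by fun_prop) fun x hx => by
      have : (0 : ℝ) < x := hx
      positivity
  · intro x hx
    have hx' : (0 : ℝ) < x := hx
    rw [abs_of_nonneg (div_nonneg (one_sub_exp_neg_nonneg (by positivity)) (sq_nonneg _)),
      div_le_iff₀ (by positivity)]
    exact one_sub_exp_neg_le _
  · intro x hx
    have hx' : (0 : ℝ) < x := hx
    rw [abs_of_nonneg (div_nonneg (one_sub_exp_neg_nonneg (by positivity)) (sq_nonneg _)),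
      rpow_neg_two hx', one_mul]
    exact div_le_div_of_nonneg_right (one_sub_exp_neg_le_one _) (sq_nonneg _)

/-- Integration by parts against the antiderivative -1/x of 1/x² reduces this to the Gaussian
integral; the boundary terms are at most a|x| near 0 and 1/x at infinity. -/
lemma integral_one_sub_exp_div_sq {a : ℝ} (ha : 0 ≤ a) :
    ∫ x in Ioi (0 : ℝ), (1 - Real.exp (-(a * x ^ 2))) / x ^ 2 = Real.sqrt (Real.pi * a) := by
  rcases ha.eq_or_lt with rfl | ha'
  · simp
  have i1 := integrableOn_one_sub_exp_div_sq ha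
  have i2 : IntegrableOn (fun x : ℝ => 2 * a * Real.exp (-a * x ^ 2)) (Ioi 0) :=
    ((integrable_exp_neg_mul_sq ha').const_mul (2 * a)).integrableOn
  have hbound0 : ∀ x : ℝ, |-(1 - Real.exp (-(a * x ^ 2))) / x| ≤ a * |x| := fun x => by
    rcases eq_or_ne x 0 with rfl | hx
    · simp
    rw [abs_div, abs_neg, abs_of_nonneg (one_sub_exp_neg_nonneg (by positivity)),
      div_le_iff₀ (abs_pos.2 hx)]
    refine (one_sub_exp_neg_le _).trans (le_of_eq ?_)
    rw [mul_assoc, abs_mul_abs_self]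
    ring
  have key := integral_Ioi_of_hasDerivAt_of_tendsto (a := (0 : ℝ)) (m := 0)
    (f := fun x => -(1 - Real.exp (-(a * x ^ 2))) / x)
    (f' := fun x => (1 - Real.exp (-(a * x ^ 2))) / x ^ 2 - 2 * a * Real.exp (-a * x ^ 2))
    ?_ ?_ (i1.sub i2) ?_
  · rw [integral_sub i1 i2, integral_const_mul, integral_gaussian_Ioi] at key
    have e : Real.sqrt (Real.pi * a) = 2 * a * (Real.sqrt (Real.pi / a) / 2) := by
      rw [show Real.pi * a = a ^ 2 * (Real.pi / a) by field_simp,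
        Real.sqrt_mul (sq_nonneg a), Real.sqrt_sq ha]
      ring
    rw [e]
    simp only [div_zero, sub_zero] at key
    linarith
  -- Division by zero gives the boundary function the value 0 at x = 0, which is also its limit
  -- there.
  · refine ContinuousAt.continuousWithinAt ?_
    rw [ContinuousAt, div_zero]
    refine squeeze_zero_norm (a := fun x => a * |x|) (fun x => hbound0 x) ?_
    have : Continuous fun x : ℝ => a * |x| := by fun_prop
    simpa using this.tendsto 0
  · intro x hx
    have hx' : (0 : ℝ) < x := hx
    have h1 : HasDerivAt (fun x : ℝ => -(a * x ^ 2)) (-(a * (2 * x))) x := by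
      refine ((hasDerivAt_pow 2 x).const_mul a).neg.congr_deriv ?_
      norm_num
    refine (((h1.exp.const_sub 1).neg).div (hasDerivAt_id' x) hx'.ne').congr_deriv ?_
    rw [neg_mul, Pi.neg_apply]
    field_simp
    ring
  · refine squeeze_zero_norm' (a := fun x : ℝ => x⁻¹) ?_ tendsto_inv_atTop_zero
    filter_upwards [eventually_gt_atTop 0] with x hx
    rw [Real.norm_eq_abs, abs_div, abs_neg, abs_of_pos hx,
      abs_of_nonneg (one_sub_exp_neg_nonneg (by positivity)), ← one_div]
    exact div_le_div_of_nonneg_right (one_sub_exp_neg_le_one _) hx.le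

/-- The normalized limit of the covariances of the increments at lag `r`. -/
def lagLim : ℕ → ℝ
  | 0 => 1
  | r + 1 => -I r / 2

/-- The lag function becomes a second difference in j of (1 - e^(-ju))/u. With u = ax² each such
term integrates to √(π/a)·√j, and this is how the second difference of square roots in `I` arises.
-/
lemma lagFun_succ_eq (r : ℕ) (u : ℝ) : lagFun (r + 1) u
    = -(2 * ((1 - Real.exp (-((r + 1) * u))) / u) - (1 - Real.exp (-((r + 2) * u))) / u
      - (1 - Real.exp (-(r * u))) / u) / 2 := by
  have x1 : Real.exp (-((r + 1 : ℝ) * u)) = Real.exp (-(r * u)) * Real.exp (-u) := by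
    rw [← Real.exp_add]; congr 1; ring
  have x2 : Real.exp (-((r + 2 : ℝ) * u)) = Real.exp (-(r * u)) * Real.exp (-u) ^ 2 := by
    rw [sq, ← Real.exp_add, ← Real.exp_add]; congr 1; ring
  rw [lagFun, x1, x2]
  ring

lemma lag_term_eq (a j x : ℝ) : (1 - Real.exp (-(j * (a * x ^ 2)))) / (a * x ^ 2)
    = a⁻¹ * ((1 - Real.exp (-(j * a * x ^ 2))) / x ^ 2) := by
  rw [mul_assoc j a, inv_mul_eq_div, div_div, mul_comm (x ^ 2)]

lemma integrableOn_lag_term {a j : ℝ} (ha : 0 < a) (hj : 0 ≤ j) :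
    IntegrableOn (fun x : ℝ => (1 - Real.exp (-(j * (a * x ^ 2)))) / (a * x ^ 2)) (Ioi 0) := by
  simp only [lag_term_eq]
  exact (integrableOn_one_sub_exp_div_sq (mul_nonneg hj ha.le)).const_mul a⁻¹

lemma integral_lag_term {a j : ℝ} (ha : 0 < a) (hj : 0 ≤ j) :
    ∫ x in Ioi (0 : ℝ), (1 - Real.exp (-(j * (a * x ^ 2)))) / (a * x ^ 2)
      = Real.sqrt (Real.pi / a) * Real.sqrt j := by
  have h := integral_one_sub_exp_div_sq (mul_nonneg hj ha.le)
  have e : Real.sqrt (Real.pi / a) * Real.sqrt j = a⁻¹ * Real.sqrt (Real.pi * (j * a)) := by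
    rw [show Real.pi * (j * a) = a ^ 2 * (Real.pi / a * j) by field_simp,
      Real.sqrt_mul (sq_nonneg a), Real.sqrt_sq ha.le, Real.sqrt_mul (by positivity),
      inv_mul_cancel_left₀ ha.ne']
  rw [e, ← h, ← integral_const_mul]
  simp only [lag_term_eq]

lemma integrableOn_lagFun (r : ℕ) {a : ℝ} (ha : 0 < a) :
    IntegrableOn (fun x : ℝ => lagFun r (a * x ^ 2)) (Ioi 0) := by
  cases r with
  | zero => simpa [lagFun] using integrableOn_lag_term ha zero_le_one
  | succ r =>
    simp only [lagFun_succ_eq]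
    exact (((((integrableOn_lag_term ha (by positivity)).const_mul 2).sub
      (integrableOn_lag_term ha (by positivity))).sub
      (integrableOn_lag_term ha (by positivity))).neg).div_const 2

lemma integral_lagFun (r : ℕ) {a : ℝ} (ha : 0 < a) :
    ∫ x in Ioi (0 : ℝ), lagFun r (a * x ^ 2) = Real.sqrt (Real.pi / a) * lagLim r := by
  cases r with
  | zero => simpa [lagFun, lagLim] using integral_lag_term ha zero_le_one
  | succ r =>
    have i1 := integrableOn_lag_term ha (j := (r : ℝ) + 1) (by positivity)
    have i2 := integrableOn_lag_term ha (j := (r : ℝ) + 2) (by positivity)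
    have i3 := integrableOn_lag_term ha (j := (r : ℝ)) (by positivity)
    have i12 : IntegrableOn (fun x : ℝ =>
        2 * ((1 - Real.exp (-(((r : ℝ) + 1) * (a * x ^ 2)))) / (a * x ^ 2))
        - (1 - Real.exp (-(((r : ℝ) + 2) * (a * x ^ 2)))) / (a * x ^ 2)) (Ioi 0) :=
      (i1.const_mul 2).sub i2
    simp only [lagFun_succ_eq]
    rw [integral_div, integral_neg, integral_sub i12 i3,
      integral_sub (i1.const_mul 2) i2, integral_const_mul, integral_lag_term ha (by positivity),
      integral_lag_term ha (by positivity), integral_lag_term ha (by positivity)]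
    simp only [lagLim, I]
    ring

lemma continuousOn_lagFun (r : ℕ) {a : ℝ} (ha : 0 < a) :
    ContinuousOn (fun x : ℝ => lagFun r (a * x ^ 2)) (Ioi 0) := by
  have hd : ContinuousOn (fun x : ℝ => (1 - Real.exp (-(a * x ^ 2))) / (a * x ^ 2)) (Ioi 0) :=
    ContinuousOn.div (by fun_prop) (by fun_prop) fun x hx => by
      have : (0 : ℝ) < x := hx
      positivity
  cases r with
  | zero => exact hd
  | succ r =>
    simp only [lagFun]
    fun_prop

/-- On each unit cell the error is at most the increment of `lagMaj`. These increments telescope to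
at most 1 - (-2) = 3, whatever r, a and N are. -/
lemma abs_sum_sub_integral_lagFun_le (r : ℕ) {a : ℝ} (ha : 0 < a) (N : ℕ) :
    |(∑ k ∈ Finset.range N, lagFun r (a * (k + 1 : ℝ) ^ 2))
      - ∫ x in (1 : ℝ)..(N + 1 : ℝ), lagFun r (a * x ^ 2)| ≤ 3 := by
  have hint : ∀ k : ℕ, IntervalIntegrable (fun x : ℝ => lagFun r (a * x ^ 2)) volume
      (k + 1 : ℝ) (k + 1 + 1 : ℝ) := fun k => by
    refine ContinuousOn.intervalIntegrable ((continuousOn_lagFun r ha).mono fun x hx => ?_)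
    rw [uIcc_of_le (by linarith)] at hx
    exact lt_of_lt_of_le (by positivity) hx.1
  have e := intervalIntegral.sum_integral_adjacent_intervals
    (f := fun x : ℝ => lagFun r (a * x ^ 2)) (μ := volume) (a := fun k : ℕ => (k + 1 : ℝ)) (n := N)
    (fun k _ => by have := hint k; push_cast; exact this)
  simp only [Nat.cast_zero, zero_add] at e
  rw [← e, ← Finset.sum_sub_distrib]
  have hterm : ∀ k ∈ Finset.range N, |lagFun r (a * (k + 1 : ℝ) ^ 2)
      - ∫ x in (k + 1 : ℝ)..((k + 1 : ℕ) + 1 : ℝ), lagFun r (a * x ^ 2)|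
      ≤ lagMaj r (a * ((k + 1 : ℕ) + 1 : ℝ) ^ 2) - lagMaj r (a * ((k : ℕ) + 1 : ℝ) ^ 2) := by
    intro k _
    push_cast
    have hc : lagFun r (a * (k + 1 : ℝ) ^ 2)
        = ∫ _ in (k + 1 : ℝ)..(k + 1 + 1 : ℝ), lagFun r (a * (k + 1 : ℝ) ^ 2) := by
      simp
    rw [hc, ← intervalIntegral.integral_sub _root_.intervalIntegrable_const (hint k)]
    have hb := intervalIntegral.norm_integral_le_of_norm_le_const (a := (k + 1 : ℝ))
      (b := (k + 1 + 1 : ℝ))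
      (f := fun x => lagFun r (a * (k + 1 : ℝ) ^ 2) - lagFun r (a * x ^ 2))
      (C := lagMaj r (a * (k + 1 + 1 : ℝ) ^ 2) - lagMaj r (a * (k + 1 : ℝ) ^ 2)) (fun x hx => ?_)
    · simpa using hb
    · rw [uIoc_of_le (by linarith)] at hx
      have hk : (0 : ℝ) < k + 1 := by positivity
      have hx0 : 0 < x := hk.trans hx.1
      have h1 : a * (k + 1 : ℝ) ^ 2 ≤ a * x ^ 2 := by
        have := hx.1.le
        gcongr
      have h2 : a * x ^ 2 ≤ a * (k + 1 + 1 : ℝ) ^ 2 := by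
        have := hx.2
        gcongr
      have m1 := abs_lagFun_sub_le r (by positivity) h1
      have m2 := (abs_nonneg _).trans (abs_lagFun_sub_le r (by positivity) h2)
      rw [Real.norm_eq_abs, abs_sub_comm]
      linarith
  refine (Finset.abs_sum_le_sum_abs _ _).trans ((Finset.sum_le_sum hterm).trans ?_)
  rw [Finset.sum_range_sub (fun k : ℕ => lagMaj r (a * ((k : ℕ) + 1 : ℝ) ^ 2))]
  have := lagMaj_le r (u := a * ((N : ℕ) + 1 : ℝ) ^ 2) (by positivity)
  have := le_lagMaj r (u := a * ((0 : ℕ) + 1 : ℝ) ^ 2) (by positivity)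
  linarith

/-- The constant is 3 from the comparison on (1, ∞) plus 1 from (0, 1], where the integrand is
bounded by 1. -/
lemma abs_tsum_sub_integral_lagFun_le (r : ℕ) {a : ℝ} (ha : 0 < a) :
    Summable (fun k : ℕ => lagFun r (a * (k + 1 : ℝ) ^ 2)) ∧
    |(∑' k : ℕ, lagFun r (a * (k + 1 : ℝ) ^ 2)) - Real.sqrt (Real.pi / a) * lagLim r| ≤ 4 := by
  have hs : Summable (fun k : ℕ => lagFun r (a * (k + 1 : ℝ) ^ 2)) := by
    refine Summable.of_norm_bounded (summable_one_div_succ_sq.mul_left (1 / a)) fun k => ?_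
    refine (abs_lagFun_le_inv r (by positivity)).trans (le_of_eq ?_)
    rw [one_div_mul_one_div]
  refine ⟨hs, ?_⟩
  have hi := integrableOn_lagFun r ha
  have h01 : IntegrableOn (fun x : ℝ => lagFun r (a * x ^ 2)) (Ioc 0 1) :=
    hi.mono_set Ioc_subset_Ioi_self
  have h1 : IntegrableOn (fun x : ℝ => lagFun r (a * x ^ 2)) (Ioi 1) :=
    hi.mono_set (Ioi_subset_Ioi zero_le_one)
  have e : ∫ x in Ioi (0 : ℝ), lagFun r (a * x ^ 2)
      = (∫ x in Ioc (0 : ℝ) 1, lagFun r (a * x ^ 2)) + ∫ x in Ioi (1 : ℝ), lagFun r (a * x ^ 2) := by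
    rw [← Ioc_union_Ioi_eq_Ioi zero_le_one, setIntegral_union (Ioc_disjoint_Ioi le_rfl)
      measurableSet_Ioi h01 h1]
  have b1 : |∫ x in Ioc (0 : ℝ) 1, lagFun r (a * x ^ 2)| ≤ 1 := by
    have := norm_setIntegral_le_of_norm_le_const (μ := volume) (s := Ioc (0 : ℝ) 1)
      (f := fun x : ℝ => lagFun r (a * x ^ 2)) (C := 1) (by simp)
      (fun x hx => abs_lagFun_le_one r (by have := hx.1; positivity))
    simpa using this
  have b2 : |(∑' k : ℕ, lagFun r (a * (k + 1 : ℝ) ^ 2))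
      - ∫ x in Ioi (1 : ℝ), lagFun r (a * x ^ 2)| ≤ 3 := by
    have t1 := hs.hasSum.tendsto_sum_nat
    have t2 := intervalIntegral_tendsto_integral_Ioi 1 h1
      (tendsto_atTop_add_const_right _ (1 : ℝ) (tendsto_natCast_atTop_atTop (R := ℝ)))
    exact le_of_tendsto' (t1.sub t2).abs (abs_sum_sub_integral_lagFun_le r ha)
  rw [← integral_lagFun r ha, e, ← sub_sub, sub_right_comm]
  refine (abs_sub _ _).trans ?_
  linarith

section

variable {θ : Fin 3 → ℝ}

/-- The cosine sum of the lag function over all modes. -/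
def cosLag (θ : Fin 3 → ℝ) (n r : ℕ) (w : ℝ) : ℝ :=
  ∑' k : ℕ, Real.cos (Real.pi * (k + 1) * w) * lagFun r (eigenvalue θ (k + 1) * mesh n)

/-- The absolute sum of the lag function over all modes. -/
def absLag (θ : Fin 3 → ℝ) (n r : ℕ) : ℝ :=
  ∑' k : ℕ, |lagFun r (eigenvalue θ (k + 1) * mesh n)|

lemma summable_cosLag (hθ : 0 < θ 2) (hpos : 0 < eigenvalue θ 1) {n : ℕ} (hn : 0 < n) (r : ℕ)
    (w : ℝ) : Summable fun k : ℕ =>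
      Real.cos (Real.pi * (k + 1) * w) * lagFun r (eigenvalue θ (k + 1) * mesh n) := by
  refine Summable.of_norm_bounded (summable_lagFun hθ hpos hn r) fun k => ?_
  rw [Real.norm_eq_abs, abs_mul]
  exact mul_le_of_le_one_left (abs_nonneg _) (Real.abs_cos_le_one _)

lemma incrCov_eq (hθ : 0 < θ 2) (hpos : 0 < eigenvalue θ 1) {n : ℕ} (hn : 0 < n) (r : ℕ)
    (y z : ℝ) : incrCov θ n r y z = cosLag θ n r (y - z) - cosLag θ n r (y + z) := by
  unfold incrCov cosLag
  rw [← (summable_cosLag hθ hpos hn r _).tsum_sub (summable_cosLag hθ hpos hn r _)]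
  refine tsum_congr fun k => ?_
  rw [sinMode_mul_sinMode, mul_sub (Real.pi * ((k : ℝ) + 1)), mul_add (Real.pi * ((k : ℝ) + 1)),
    Real.cos_sub, Real.cos_add]
  ring

lemma abs_cosLag_le_absLag (hθ : 0 < θ 2) (hpos : 0 < eigenvalue θ 1) {n : ℕ} (hn : 0 < n) (r : ℕ)
    (w : ℝ) : |cosLag θ n r w| ≤ absLag θ n r := by
  unfold cosLag absLag
  rw [← Real.norm_eq_abs]
  refine tsum_of_norm_bounded (summable_lagFun hθ hpos hn r).hasSum fun k => ?_
  rw [Real.norm_eq_abs, abs_mul]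
  exact mul_le_of_le_one_left (abs_nonneg _) (Real.abs_cos_le_one _)

lemma abs_incrCov_le (hθ : 0 < θ 2) (hpos : 0 < eigenvalue θ 1) {n : ℕ} (hn : 0 < n) (r : ℕ)
    (y z : ℝ) : |incrCov θ n r y z| ≤ 2 * absLag θ n r := by
  rw [incrCov_eq hθ hpos hn]
  refine (abs_sub _ _).trans ?_
  linarith [abs_cosLag_le_absLag hθ hpos hn r (y - z), abs_cosLag_le_absLag hθ hpos hn r (y + z)]

lemma abs_cosLag_le (hθ : 0 < θ 2) (hpos : 0 < eigenvalue θ 1) {n : ℕ} (hn : 0 < n) (r : ℕ)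
    {w : ℝ} (hw : Real.sin (Real.pi * w / 2) ≠ 0) :
    |cosLag θ n r w| ≤ 4 * (1 / |Real.sin (Real.pi * w / 2)|) := by
  have hm := mesh_pos hn
  have hu : ∀ k : ℕ, 0 < eigenvalue θ (k + 1) * mesh n := fun k =>
    mul_pos (eigenvalue_pos hθ hpos k) hm
  refine le_of_tendsto' (summable_cosLag hθ hpos hn r w).hasSum.tendsto_sum_nat.abs fun N => ?_
  refine abs_sum_mul_le (c := fun k : ℕ => Real.cos (Real.pi * (k + 1) * w))
    (b := fun k => lagFun r (eigenvalue θ (k + 1) * mesh n))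
    (h := fun k => lagMaj r (eigenvalue θ (k + 1) * mesh n)) (abs_sum_cos_le hw)
    (fun k => abs_lagFun_le_one r (hu k)) (fun k => ?_) (fun k => lagMaj_le r (hu k))
    (fun k => le_lagMaj r (hu k)) N
  -- The eigenvalues increase with k, so the variation along the modes is controlled by `lagMaj`.
  refine abs_lagFun_sub_le r (hu k) (mul_le_mul_of_nonneg_right ?_ hm.le)
  unfold eigenvalue
  have : ((k + 1 : ℕ) : ℝ) ≤ ((k + 1 + 1 : ℕ) : ℝ) := by push_cast; linarith
  gcongr

/-- The sums of the lag functions over the modes are close to the corresponding integrals,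
uniformly in the lag and the mesh. -/
lemma exists_abs_tsum_lagFun_sub_le (hθ : 0 < θ 2) (hpos : 0 < eigenvalue θ 1) :
    ∃ C, 0 < C ∧ ∀ n : ℕ, 0 < n → ∀ r : ℕ,
      |cosLag θ n r 0 - 1 / Real.sqrt (Real.pi * θ 2) / Real.sqrt (mesh n) * lagLim r| ≤ C := by
  obtain ⟨c, hc, hcμ, hcl⟩ := exists_eigenvalue_lower_bound hθ hpos
  set b := |-θ 0 + θ 1 ^ 2 / (4 * θ 2)| with hb
  refine ⟨(∑' k : ℕ, 3 * (b / c) * (1 / (k + 1 : ℝ) ^ 2)) + 4, ?_, fun n hn r => ?_⟩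
  · have : 0 ≤ ∑' k : ℕ, 3 * (b / c) * (1 / (k + 1 : ℝ) ^ 2) :=
      tsum_nonneg fun k => by positivity
    linarith
  have hm := mesh_pos hn
  have ha : 0 < Real.pi ^ 2 * θ 2 * mesh n := by positivity
  obtain ⟨hs, hI⟩ := abs_tsum_sub_integral_lagFun_le r ha
  have hs' := summable_cosLag hθ hpos hn r 0
  have e : Real.sqrt (Real.pi / (Real.pi ^ 2 * θ 2 * mesh n))
      = 1 / Real.sqrt (Real.pi * θ 2) / Real.sqrt (mesh n) := by
    rw [div_div, ← Real.sqrt_mul (by positivity), ← Real.sqrt_one, ← Real.sqrt_div zero_le_one]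
    congr 1
    field_simp
  rw [e] at hI
  -- The arguments of the two series differ by a constant times Δ, while both are at least c(k+1)²Δ.
  -- The quotient is free of Δ and summable in k.
  have hdiff : |cosLag θ n r 0 - ∑' k : ℕ, lagFun r (Real.pi ^ 2 * θ 2 * mesh n * (k + 1 : ℝ) ^ 2)|
      ≤ ∑' k : ℕ, 3 * (b / c) * (1 / (k + 1 : ℝ) ^ 2) := by
    unfold cosLag
    rw [← hs'.tsum_sub hs, ← Real.norm_eq_abs]
    refine tsum_of_norm_bounded (summable_one_div_succ_sq.mul_left _).hasSum fun k => ?_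
    rw [mul_zero, Real.cos_zero, one_mul, Real.norm_eq_abs]
    have hk : (0 : ℝ) < (k + 1 : ℝ) ^ 2 := by positivity
    have h1 : c * (k + 1 : ℝ) ^ 2 * mesh n ≤ eigenvalue θ (k + 1) * mesh n :=
      mul_le_mul_of_nonneg_right (hcl k) hm.le
    have h2 : c * (k + 1 : ℝ) ^ 2 * mesh n ≤ Real.pi ^ 2 * θ 2 * mesh n * (k + 1 : ℝ) ^ 2 := by
      calc c * (k + 1 : ℝ) ^ 2 * mesh n ≤ (Real.pi ^ 2 * θ 2) * (k + 1 : ℝ) ^ 2 * mesh n := by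
            gcongr
        _ = _ := by ring
    refine (abs_lagFun_sub_le_min r (by positivity) h1 h2).trans (le_of_eq ?_)
    have h3 : eigenvalue θ (k + 1) * mesh n - Real.pi ^ 2 * θ 2 * mesh n * (k + 1 : ℝ) ^ 2
        = (-θ 0 + θ 1 ^ 2 / (4 * θ 2)) * mesh n := by
      unfold eigenvalue
      push_cast
      ring
    rw [h3, abs_mul, abs_of_pos hm, ← hb]
    field_simp
  have := abs_sub_le (cosLag θ n r 0)
    (∑' k : ℕ, lagFun r (Real.pi ^ 2 * θ 2 * mesh n * (k + 1 : ℝ) ^ 2))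
    (1 / Real.sqrt (Real.pi * θ 2) / Real.sqrt (mesh n) * lagLim r)
  linarith

/-- From lag 1 on, the absolute values form a geometric series that telescopes to at most half of
the value at lag 0. Hence summing over all lags costs only a constant factor. -/
lemma sum_abs_lagFun_le (R : ℕ) {u : ℝ} (hu : 0 < u) :
    ∑ r ∈ Finset.range R, |lagFun r u| ≤ 2 * lagFun 0 u := by
  have h0 := one_sub_exp_neg_nonneg hu.le
  have hγ : 0 ≤ lagFun 0 u := div_one_sub_exp_nonneg hu
  have key : ∀ R : ℕ, ∑ r ∈ Finset.range R, |lagFun (r + 1) u|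
      = (1 - Real.exp (-(R * u))) * lagFun 0 u / 2 := by
    intro R
    induction R with
    | zero => simp
    | succ R ih =>
      have x1 : Real.exp (-(((R + 1 : ℕ) : ℝ) * u)) = Real.exp (-(R * u)) * Real.exp (-u) := by
        rw [← Real.exp_add]; congr 1; push_cast; ring
      have h1 : 0 ≤ Real.exp (-(R * u)) * (1 - Real.exp (-u)) * ((1 - Real.exp (-u)) / u) :=
        mul_nonneg (mul_nonneg (Real.exp_nonneg _) h0) hγ
      rw [Finset.sum_range_succ, ih, x1]
      simp only [lagFun]
      rw [neg_div, abs_neg, abs_of_nonneg (by linarith)]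
      ring
  cases R with
  | zero => simpa using hγ
  | succ R =>
    rw [Finset.sum_range_succ', key, abs_of_nonneg hγ]
    nlinarith [mul_le_mul_of_nonneg_right (one_sub_exp_neg_le_one (R * u)) hγ]

lemma sum_absLag_le (hθ : 0 < θ 2) (hpos : 0 < eigenvalue θ 1) {n : ℕ} (hn : 0 < n) (R : ℕ) :
    ∑ r ∈ Finset.range R, absLag θ n r ≤ 2 * cosLag θ n 0 0 := by
  have hm := mesh_pos hn
  have hs := summable_cosLag hθ hpos hn 0 0
  unfold absLag cosLag
  rw [← Summable.tsum_finsetSum fun r _ => summable_lagFun hθ hpos hn r, ← tsum_mul_left]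
  refine Summable.tsum_le_tsum (fun k => ?_)
    (summable_sum fun r _ => summable_lagFun hθ hpos hn r) (hs.mul_left 2)
  rw [mul_zero, Real.cos_zero, one_mul]
  exact sum_abs_lagFun_le R (mul_pos (eigenvalue_pos hθ hpos k) hm)

lemma mesh_le_one {n : ℕ} (hn : 0 < n) : mesh n ≤ 1 := by
  unfold mesh
  rw [div_le_one (by exact_mod_cast hn)]
  exact_mod_cast hn

lemma one_le_inv_sqrt_mesh {n : ℕ} (hn : 0 < n) : 1 ≤ 1 / Real.sqrt (mesh n) := by
  rw [le_div_iff₀ (Real.sqrt_pos.2 (mesh_pos hn)), one_mul, Real.sqrt_le_one]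
  exact mesh_le_one hn

lemma exists_sum_absLag_le (hθ : 0 < θ 2) (hpos : 0 < eigenvalue θ 1) :
    ∃ C, 0 < C ∧ ∀ n : ℕ, 0 < n → ∀ R : ℕ,
      ∑ r ∈ Finset.range R, absLag θ n r ≤ C * (1 / Real.sqrt (mesh n)) := by
  obtain ⟨C, hC, h⟩ := exists_abs_tsum_lagFun_sub_le hθ hpos
  refine ⟨2 * (1 / Real.sqrt (Real.pi * θ 2) + C), by positivity, fun n hn R => ?_⟩
  refine (sum_absLag_le hθ hpos hn R).trans ?_
  have h1 := (abs_le.1 (h n hn 0)).2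
  have h2 := one_le_inv_sqrt_mesh hn
  simp only [lagLim, mul_one] at h1
  have h3 : C * 1 ≤ C * (1 / Real.sqrt (mesh n)) := mul_le_mul_of_nonneg_left h2 hC.le
  rw [div_eq_mul_one_div _ (Real.sqrt (mesh n))] at h1
  nlinarith

end

/-! ### Lower bounds for the sine -/

/-- Jordan's inequality on [0, 1], reflected by w ↦ 2 - w on [1, 2]. -/
lemma min_le_sin {w : ℝ} (h0 : 0 ≤ w) (h2 : w ≤ 2) :
    min w (2 - w) ≤ Real.sin (Real.pi * w / 2) := by
  have hpi := Real.pi_pos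
  have key : ∀ {v : ℝ}, 0 ≤ v → v ≤ 1 → v ≤ Real.sin (Real.pi * v / 2) := fun {v} hv hv1 => by
    have := Real.mul_le_sin (x := Real.pi * v / 2) (by positivity) (by nlinarith)
    rwa [show 2 / Real.pi * (Real.pi * v / 2) = v by field_simp] at this
  rcases le_total w 1 with h | h
  · exact (min_le_left _ _).trans (key h0 h)
  · have := key (v := 2 - w) (by linarith) (by linarith)
    rw [show Real.pi * (2 - w) / 2 = Real.pi - Real.pi * w / 2 by ring, Real.sin_pi_sub] at this
    exact (min_le_right _ _).trans this

/-! ### The constants `I r` -/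

/-- The increments of the square root. -/
def sqrtIncr (r : ℕ) : ℝ := Real.sqrt ((r : ℝ) + 1) - Real.sqrt (r : ℝ)

lemma I_eq (r : ℕ) : I r = sqrtIncr r - sqrtIncr (r + 1) := by
  unfold I sqrtIncr
  push_cast
  rw [show (r : ℝ) + 1 + 1 = r + 2 by ring]
  ring

lemma sqrtIncr_nonneg (r : ℕ) : 0 ≤ sqrtIncr r :=
  sub_nonneg.2 (Real.sqrt_le_sqrt (by linarith))

lemma sqrtIncr_eq (r : ℕ) : sqrtIncr r = 1 / (Real.sqrt ((r : ℝ) + 1) + Real.sqrt (r : ℝ)) := by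
  have h1 := Real.sq_sqrt (by positivity : (0 : ℝ) ≤ (r : ℝ) + 1)
  have h2 := Real.sq_sqrt (by positivity : (0 : ℝ) ≤ (r : ℝ))
  have h3 : 0 < Real.sqrt ((r : ℝ) + 1) := Real.sqrt_pos.2 (by positivity)
  have h4 := Real.sqrt_nonneg (r : ℝ)
  rw [eq_div_iff (by positivity), sqrtIncr]
  nlinarith

/-- In this rationalized form positivity and monotonicity in r are visible. -/
lemma I_eq_div (r : ℕ) : I r = 2 / ((Real.sqrt ((r : ℝ) + 1) + Real.sqrt (r : ℝ))
    * (Real.sqrt ((r : ℝ) + 2) + Real.sqrt ((r : ℝ) + 1))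
    * (Real.sqrt ((r : ℝ) + 2) + Real.sqrt (r : ℝ))) := by
  have h1 := Real.sq_sqrt (by positivity : (0 : ℝ) ≤ (r : ℝ) + 2)
  have h2 := Real.sq_sqrt (by positivity : (0 : ℝ) ≤ (r : ℝ))
  have h3 : 0 < Real.sqrt ((r : ℝ) + 1) := Real.sqrt_pos.2 (by positivity)
  have h4 : 0 < Real.sqrt ((r : ℝ) + 2) := Real.sqrt_pos.2 (by positivity)
  have h5 := Real.sqrt_nonneg (r : ℝ)
  rw [I_eq, sqrtIncr_eq, sqrtIncr_eq]
  push_cast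
  rw [show (r : ℝ) + 1 + 1 = r + 2 by ring]
  rw [div_sub_div _ _ (by positivity) (by positivity), div_eq_div_iff (by positivity)
    (by positivity)]
  have e : (Real.sqrt ((r : ℝ) + 2) - Real.sqrt r) * (Real.sqrt ((r : ℝ) + 2) + Real.sqrt r)
      = 2 := by nlinarith
  linear_combination ((Real.sqrt ((r : ℝ) + 1) + Real.sqrt (r : ℝ))
    * (Real.sqrt ((r : ℝ) + 2) + Real.sqrt ((r : ℝ) + 1))) * e

lemma I_nonneg (r : ℕ) : 0 ≤ I r := by
  rw [I_eq_div]
  positivity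

lemma I_antitone : Antitone I := by
  refine antitone_nat_of_succ_le fun r => ?_
  have h3 : 0 < Real.sqrt ((r : ℝ) + 1) := Real.sqrt_pos.2 (by positivity)
  have h4 : 0 < Real.sqrt ((r : ℝ) + 2) := Real.sqrt_pos.2 (by positivity)
  have h5 := Real.sqrt_nonneg (r : ℝ)
  have a1 : Real.sqrt (r : ℝ) ≤ Real.sqrt ((r : ℝ) + 1) := Real.sqrt_le_sqrt (by linarith)
  have a2 : Real.sqrt ((r : ℝ) + 1) ≤ Real.sqrt ((r : ℝ) + 2) := Real.sqrt_le_sqrt (by linarith)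
  have a3 : Real.sqrt ((r : ℝ) + 2) ≤ Real.sqrt ((r : ℝ) + 3) := Real.sqrt_le_sqrt (by linarith)
  rw [I_eq_div, I_eq_div]
  push_cast
  rw [show (r : ℝ) + 1 + 1 = r + 2 by ring, show (r : ℝ) + 1 + 2 = r + 3 by ring]
  gcongr

lemma sum_I_eq (m N : ℕ) : ∑ r ∈ Finset.range N, I (r + m) = sqrtIncr m - sqrtIncr (N + m) := by
  induction N with
  | zero => simp
  | succ N ih =>
    rw [Finset.sum_range_succ, ih, I_eq, show N + 1 + m = N + m + 1 by ring]
    ring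

lemma sum_I_le (m N : ℕ) : ∑ r ∈ Finset.range N, I (r + m) ≤ sqrtIncr m := by
  rw [sum_I_eq]
  linarith [sqrtIncr_nonneg (N + m)]

/-- One factor is at most `I m` by monotonicity; the sum of the other telescopes. -/
lemma sum_I_sq_le (m N : ℕ) : ∑ r ∈ Finset.range N, I (r + m) ^ 2 ≤ I m * sqrtIncr m := by
  calc ∑ r ∈ Finset.range N, I (r + m) ^ 2 ≤ ∑ r ∈ Finset.range N, I m * I (r + m) :=
        Finset.sum_le_sum fun r _ => by
          rw [sq]
          exact mul_le_mul_of_nonneg_right (I_antitone (by omega)) (I_nonneg _)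
    _ ≤ I m * sqrtIncr m := by
        rw [← Finset.mul_sum]
        exact mul_le_mul_of_nonneg_left (sum_I_le m N) (I_nonneg m)

lemma summable_I_sq_add (m : ℕ) : Summable fun r : ℕ => I (r + m) ^ 2 :=
  summable_of_sum_range_le (fun _ => sq_nonneg _) (sum_I_sq_le m)

lemma summable_I_sq : Summable fun r : ℕ => I r ^ 2 := summable_I_sq_add 0

lemma tsum_I_sq_le (m : ℕ) : ∑' r : ℕ, I (r + m) ^ 2 ≤ I m * sqrtIncr m :=
  (summable_I_sq_add m).tsum_le_of_sum_range_le (sum_I_sq_le m)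

lemma sqrtIncr_zero : sqrtIncr 0 = 1 := by simp [sqrtIncr]

/-- These tails are what a finite double sum misses of the full series. Each is at most `I m`, and
the `I m` telescope to at most 1, so the total loss stays bounded in p. -/
lemma sum_tsum_I_sq_le (p : ℕ) : ∑ m ∈ Finset.range p, ∑' r : ℕ, I (r + m) ^ 2 ≤ 1 := by
  have hd : ∀ m, sqrtIncr m ≤ 1 := fun m => by
    induction m with
    | zero => exact sqrtIncr_zero.le
    | succ m ih => linarith [I_eq m, I_nonneg m]
  calc ∑ m ∈ Finset.range p, ∑' r : ℕ, I (r + m) ^ 2 ≤ ∑ m ∈ Finset.range p, I (m + 0) :=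
        Finset.sum_le_sum fun m _ => (tsum_I_sq_le m).trans
          (mul_le_of_le_one_right (I_nonneg m) (hd m))
    _ ≤ 1 := (sum_I_le 0 p).trans sqrtIncr_zero.le

lemma sum_abs_lagLim_le (R : ℕ) : ∑ r ∈ Finset.range R, |lagLim r| ≤ 2 := by
  cases R with
  | zero => simp
  | succ R =>
    rw [Finset.sum_range_succ']
    have : ∀ r, |lagLim (r + 1)| = I (r + 0) / 2 := fun r => by
      rw [lagLim, abs_div, abs_neg, abs_of_nonneg (I_nonneg r), abs_two, add_zero]
    simp only [this, ← Finset.sum_div]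
    have h := sum_I_le 0 R
    rw [sqrtIncr_zero] at h
    simp only [lagLim, abs_one]
    linarith

lemma gammaConst_bounds : 0.745 < gammaConst ∧ gammaConst < 0.755 := by
  have hπ1 := Real.pi_gt_d4
  have hπ2 := Real.pi_lt_d4
  have hπ := Real.pi_pos
  have e : gammaConst = (∑' r : ℕ, I r ^ 2 + 2) / Real.pi := by
    unfold gammaConst
    ring
  -- The two leading terms are evaluated numerically and the tail is at most `I 2 * sqrtIncr 2`. The
  -- lower bound for Γ needs only the term r = 0.
  have hs : ∑' r : ℕ, I r ^ 2 = I 0 ^ 2 + I 1 ^ 2 + ∑' r : ℕ, I (r + 2) ^ 2 := by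
    rw [← summable_I_sq.sum_add_tsum_nat_add 2]
    simp [Finset.sum_range_succ]
  have ht0 : 0 ≤ ∑' r : ℕ, I (r + 2) ^ 2 := tsum_nonneg fun _ => sq_nonneg _
  have ht := tsum_I_sq_le 2
  have s2l : 1.41421 < Real.sqrt 2 := Real.lt_sqrt_of_sq_lt (by norm_num)
  have s2u : Real.sqrt 2 < 1.41422 := (Real.sqrt_lt' (by norm_num)).2 (by norm_num)
  have s3l : 1.73205 < Real.sqrt 3 := Real.lt_sqrt_of_sq_lt (by norm_num)
  have s3u : Real.sqrt 3 < 1.73206 := (Real.sqrt_lt' (by norm_num)).2 (by norm_num)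
  have s4 : Real.sqrt 4 = 2 := by
    rw [show (4 : ℝ) = 2 ^ 2 by norm_num, Real.sqrt_sq zero_le_two]
  have e0 : I 0 = 2 - Real.sqrt 2 := by simp [I]
  have e1 : I 1 = 2 * Real.sqrt 2 - Real.sqrt 3 - 1 := by
    unfold I; norm_num
  have e2 : I 2 = 2 * Real.sqrt 3 - 2 - Real.sqrt 2 := by
    unfold I; norm_num [s4]
  have e3 : sqrtIncr 2 = Real.sqrt 3 - Real.sqrt 2 := by
    unfold sqrtIncr; norm_num
  have b0l : 0.3431 < I 0 ^ 2 := by rw [e0]; nlinarith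
  have b0u : I 0 ^ 2 < 0.3433 := by rw [e0]; nlinarith
  have b1 : I 1 ^ 2 < 0.0094 := by rw [e1]; nlinarith
  have b2 : I 2 * sqrtIncr 2 < 0.0161 := by rw [e2, e3]; nlinarith
  rw [e, hs]
  constructor
  · rw [lt_div_iff₀ hπ]
    nlinarith [sq_nonneg (I 1)]
  · rw [div_lt_iff₀ hπ]
    nlinarith

/-! ### Double sums over the lags -/

/-- Passing from p to p + 1 adds one corner and two equal arms to the square of indices. -/
lemma double_sum_succ (F : ℕ → ℝ) (p : ℕ) :
    ∑ i ∈ Finset.range (p + 1), ∑ j ∈ Finset.range (p + 1), F (Nat.dist i j)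
      = (∑ i ∈ Finset.range p, ∑ j ∈ Finset.range p, F (Nat.dist i j))
        + (F 0 + 2 * ∑ r ∈ Finset.range p, F (r + 1)) := by
  have h : ∑ i ∈ Finset.range p, F (Nat.dist i p) = ∑ r ∈ Finset.range p, F (r + 1) := by
    rw [← Finset.sum_range_reflect]
    refine Finset.sum_congr rfl fun r hr => ?_
    have hr' := Finset.mem_range.1 hr
    congr 1
    rw [Nat.dist_eq_sub_of_le (by omega)]
    omega
  rw [Finset.sum_range_succ, Finset.sum_range_succ _ p]
  simp only [Finset.sum_range_succ _ p, Finset.sum_add_distrib, Nat.dist_comm p, Nat.dist_self, h]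
  ring

lemma double_sum_le {F : ℕ → ℝ} (hF : ∀ r, 0 ≤ F r) {p q : ℕ} (hpq : p ≤ q) :
    ∑ i ∈ Finset.range p, ∑ j ∈ Finset.range p, F (Nat.dist i j)
      ≤ 2 * p * ∑ r ∈ Finset.range q, F r := by
  induction p with
  | zero => simp
  | succ p ih =>
    rw [double_sum_succ]
    have h1 := ih (by omega)
    have h2 : ∑ r ∈ Finset.range (p + 1), F r ≤ ∑ r ∈ Finset.range q, F r :=
      Finset.sum_le_sum_of_subset_of_nonneg (Finset.range_mono hpq) fun _ _ _ => hF _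
    rw [Finset.sum_range_succ'] at h2
    have := hF 0
    push_cast
    linarith

/-- The p-th step adds 1 + ½ ∑_{r<p} I(r)², which is πΓ/2 minus half the tail from p on. -/
lemma double_sum_lagLim (p : ℕ) :
    ∑ i ∈ Finset.range p, ∑ j ∈ Finset.range p, lagLim (Nat.dist i j) ^ 2
      = p * (Real.pi / 2 * gammaConst)
        - (∑ m ∈ Finset.range p, ∑' r : ℕ, I (r + m) ^ 2) / 2 := by
  have hΓ : Real.pi / 2 * gammaConst = 1 + (∑' r : ℕ, I r ^ 2) / 2 := by
    unfold gammaConst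
    have := Real.pi_pos
    field_simp
    ring
  induction p with
  | zero => simp
  | succ p ih =>
    rw [double_sum_succ (fun r => lagLim r ^ 2), ih, Finset.sum_range_succ, hΓ,
      ← summable_I_sq.sum_add_tsum_nat_add p]
    have : ∀ r, lagLim (r + 1) ^ 2 = I r ^ 2 / 4 := fun r => by
      rw [lagLim]; ring
    simp only [this, ← Finset.sum_div]
    rw [lagLim]
    push_cast
    ring

/-! ### The expansion of the covariances -/

section

variable {θ : Fin 3 → ℝ}

/-- One factor of the square is bounded uniformly by D, the other is summed over the lags. -/
lemma sum_incrCov_sq_le (hθ : 0 < θ 2) (hpos : 0 < eigenvalue θ 1) {C : ℝ} {n : ℕ} (hn : 0 < n)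
    (hC : ∀ R : ℕ, ∑ r ∈ Finset.range R, absLag θ n r ≤ C * (1 / Real.sqrt (mesh n)))
    {y z D : ℝ} (hD : ∀ r, |incrCov θ n r y z| ≤ D) (p : ℕ) :
    ∑ r ∈ Finset.range p, incrCov θ n r y z ^ 2 ≤ D * (2 * (C * (1 / Real.sqrt (mesh n)))) := by
  have hD0 : 0 ≤ D := (abs_nonneg _).trans (hD 0)
  calc ∑ r ∈ Finset.range p, incrCov θ n r y z ^ 2
      ≤ ∑ r ∈ Finset.range p, D * (2 * absLag θ n r) := Finset.sum_le_sum fun r _ => by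
        rw [← sq_abs, sq]
        exact mul_le_mul (hD r) (abs_incrCov_le hθ hpos hn r y z) (abs_nonneg _) hD0
    _ = D * (2 * ∑ r ∈ Finset.range p, absLag θ n r) := by rw [← Finset.mul_sum, ← Finset.mul_sum]
    _ ≤ _ := by
        have := hC p
        gcongr

lemma abs_cosLag_add_le (hθ : 0 < θ 2) (hpos : 0 < eigenvalue θ 1) {n : ℕ} (hn : 0 < n) (r : ℕ)
    {δ y z : ℝ} (hδ : 0 < δ) (hy : y ∈ Icc δ (1 - δ)) (hz : z ∈ Icc δ (1 - δ)) :
    |cosLag θ n r (y + z)| ≤ 4 * δ⁻¹ := by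
  have h := min_le_sin (w := y + z) (by linarith [hy.1, hz.1]) (by linarith [hy.2, hz.2])
  have h' : δ ≤ min (y + z) (2 - (y + z)) :=
    le_min (by linarith [hy.1, hz.1]) (by linarith [hy.2, hz.2])
  have hs : δ ≤ Real.sin (Real.pi * (y + z) / 2) := h'.trans h
  have hs0 := hδ.trans_le hs
  refine (abs_cosLag_le hθ hpos hn r hs0.ne').trans ?_
  rw [abs_of_pos hs0, ← one_div]
  exact mul_le_mul_of_nonneg_left (one_div_le_one_div_of_le hδ hs) (by norm_num)

lemma abs_cosLag_sub_le (hθ : 0 < θ 2) (hpos : 0 < eigenvalue θ 1) {n : ℕ} (hn : 0 < n) (r : ℕ)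
    {δ y z : ℝ} (hδ : 0 < δ) (hy : y ∈ Icc δ (1 - δ)) (hz : z ∈ Icc δ (1 - δ)) (hyz : y ≠ z) :
    |cosLag θ n r (y - z)| ≤ 4 * |y - z|⁻¹ := by
  have hw : 0 < |y - z| := abs_pos.2 (sub_ne_zero.2 hyz)
  have hw1 : |y - z| ≤ 1 := by
    rw [abs_le]
    constructor <;> linarith [hy.1, hy.2, hz.1, hz.2]
  have h := min_le_sin hw.le (by linarith)
  rw [min_eq_left (by linarith)] at h
  have e : |Real.sin (Real.pi * (y - z) / 2)| = Real.sin (Real.pi * |y - z| / 2) := by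
    rcases abs_cases (y - z) with ⟨h1, -⟩ | ⟨h1, -⟩
    · rw [h1] at h hw ⊢
      exact abs_of_pos (hw.trans_le h)
    · rw [h1] at h hw ⊢
      rw [← abs_of_pos (hw.trans_le h), mul_neg, neg_div, Real.sin_neg, abs_neg]
  have hs0 : 0 < |Real.sin (Real.pi * (y - z) / 2)| := by rw [e]; exact hw.trans_le h
  refine (abs_cosLag_le hθ hpos hn r (abs_pos.1 hs0)).trans ?_
  rw [e, ← one_div]
  exact mul_le_mul_of_nonneg_left (one_div_le_one_div_of_le hw h) (by norm_num)

lemma mesh_mul_inv_sqrt {n : ℕ} (hn : 0 < n) :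
    mesh n * (1 / Real.sqrt (mesh n)) = Real.sqrt (mesh n) := by
  have h := mesh_pos hn
  have hs := Real.sqrt_pos.2 h
  rw [mul_one_div, div_eq_iff hs.ne', Real.mul_self_sqrt h.le]

/-- Factor a² - b² = (a - b)(a + b). The difference is O(δ⁻¹) uniformly in the lag, and the sum of
the two terms is summable over the lags to O(Δ^(-1/2)). -/
lemma sum_abs_incrCov_sq_sub_le (hθ : 0 < θ 2) (hpos : 0 < eigenvalue θ 1) {A B κ : ℝ} {n : ℕ}
    (hn : 0 < n)
    (hA : ∀ R : ℕ, ∑ r ∈ Finset.range R, absLag θ n r ≤ A * (1 / Real.sqrt (mesh n)))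
    (hB0 : 0 < B) (hκ : 0 < κ)
    (hB : ∀ r : ℕ, |cosLag θ n r 0 - κ / Real.sqrt (mesh n) * lagLim r| ≤ B)
    {δ y : ℝ} (hδ : 0 < δ) (hy : y ∈ Icc δ (1 - δ)) (p : ℕ) :
    ∑ r ∈ Finset.range p, |incrCov θ n r y y ^ 2 - (κ / Real.sqrt (mesh n) * lagLim r) ^ 2|
      ≤ ((B + 4) * δ⁻¹ * (2 * A + 2 * κ)) * (1 / Real.sqrt (mesh n)) := by
  have hs := Real.sqrt_pos.2 (mesh_pos hn)
  have hδ1 : 1 ≤ δ⁻¹ := (one_le_inv₀ hδ).2 (by linarith [hy.1, hy.2])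
  have hterm : ∀ r, |incrCov θ n r y y ^ 2 - (κ / Real.sqrt (mesh n) * lagLim r) ^ 2|
      ≤ ((B + 4) * δ⁻¹) * (2 * absLag θ n r + κ / Real.sqrt (mesh n) * |lagLim r|) := by
    intro r
    rw [sq_sub_sq, abs_mul, mul_comm]
    refine mul_le_mul ?_ ?_ (abs_nonneg _) (by positivity)
    · have b1 := hB r
      have b2 := abs_cosLag_add_le hθ hpos hn r hδ hy hy
      rw [incrCov_eq hθ hpos hn, sub_self, sub_right_comm]
      refine (abs_sub _ _).trans ?_
      nlinarith
    · refine (abs_add_le _ _).trans (add_le_add (abs_incrCov_le hθ hpos hn r y y) ?_)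
      rw [abs_mul, abs_of_pos (by positivity)]
  calc _ ≤ ∑ r ∈ Finset.range p,
        ((B + 4) * δ⁻¹) * (2 * absLag θ n r + κ / Real.sqrt (mesh n) * |lagLim r|) :=
        Finset.sum_le_sum fun r _ => hterm r
    _ = ((B + 4) * δ⁻¹) * (2 * (∑ r ∈ Finset.range p, absLag θ n r)
          + κ / Real.sqrt (mesh n) * ∑ r ∈ Finset.range p, |lagLim r|) := by
        rw [← Finset.mul_sum, Finset.sum_add_distrib, ← Finset.mul_sum, ← Finset.mul_sum]
    _ ≤ ((B + 4) * δ⁻¹) * (2 * (A * (1 / Real.sqrt (mesh n)))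
          + κ / Real.sqrt (mesh n) * 2) := by
        have := hA p
        have := sum_abs_lagLim_le p
        gcongr
    _ = _ := by ring

/-- The expansion of the covariances of the realized volatilities, in terms of the covariances of
the increments. -/
lemma exists_double_sum_expansion (hθ : 0 < θ 2) (hpos : 0 < eigenvalue θ 1) :
    ∃ C, 0 < C ∧ ∀ n p : ℕ, 1 ≤ p → p ≤ n → ∀ δ : ℝ, 0 < δ →
      ∀ y ∈ Icc δ (1 - δ), ∀ z ∈ Icc δ (1 - δ), ∃ r₁ r₂ : ℝ, |r₁| ≤ (p : ℝ)⁻¹ ∧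
        |r₂| ≤ C * (Real.sqrt (mesh n) / p * ((if y ≠ z then |y - z|⁻¹ else 0) + δ⁻¹)) ∧
        2 * mesh n / (p : ℝ) ^ 2 * ∑ i ∈ Finset.range p, ∑ j ∈ Finset.range p,
            incrCov θ n (Nat.dist i j) y z ^ 2
          = (if y = z then (p : ℝ)⁻¹ * gammaConst * (θ 2)⁻¹ * (1 + r₁) else 0) + r₂ := by
  obtain ⟨A, hA, hAsum⟩ := exists_sum_absLag_le hθ hpos
  obtain ⟨B, hB, hBdiff⟩ := exists_abs_tsum_lagFun_sub_le hθ hpos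
  set κ := 1 / Real.sqrt (Real.pi * θ 2) with hκ
  have hκ0 : 0 < κ := by
    have : 0 < Real.sqrt (Real.pi * θ 2) := Real.sqrt_pos.2 (by positivity)
    positivity
  have hκ2 : κ ^ 2 = 1 / (Real.pi * θ 2) := by
    rw [hκ, div_pow, one_pow, Real.sq_sqrt (by positivity)]
  -- The term `32 * A` covers y ≠ z, the other term y = z; both include the factor 4 from `hpre`.
  refine ⟨32 * A + 4 * (B + 4) * (2 * A + 2 * κ), by positivity, ?_⟩
  intro n p hp hpn δ hδ y hy z hz
  have hn : 0 < n := by omega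
  have hm := mesh_pos hn
  have hs := Real.sqrt_pos.2 hm
  have hp' : (0 : ℝ) < p := by exact_mod_cast hp
  have hpi := Real.pi_pos
  -- the prefactor applied to a bound of a double sum
  have hpre : ∀ T : ℝ, 2 * mesh n / (p : ℝ) ^ 2 * (2 * p * (T * (1 / Real.sqrt (mesh n))))
      = 4 * T * (Real.sqrt (mesh n) / p) := fun T => by
    calc 2 * mesh n / (p : ℝ) ^ 2 * (2 * p * (T * (1 / Real.sqrt (mesh n))))
        = 4 * T * (mesh n * (1 / Real.sqrt (mesh n)) / p) := by
          field_simp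
          ring
      _ = _ := by rw [mesh_mul_inv_sqrt hn]
  have hpre0 : 0 ≤ 2 * mesh n / (p : ℝ) ^ 2 := by positivity
  by_cases hyz : y = z
  · subst hyz
    set t := (∑ m ∈ Finset.range p, ∑' r : ℕ, I (r + m) ^ 2) / 2 with ht
    have ht0 : 0 ≤ t := div_nonneg
      (Finset.sum_nonneg fun m _ => tsum_nonneg fun _ => sq_nonneg _) zero_le_two
    have ht1 : t ≤ 1 / 2 := by linarith [sum_tsum_I_sq_le p]
    have hΓ := gammaConst_bounds.1
    have hΓ1 : 1 ≤ Real.pi / 2 * gammaConst := by nlinarith [Real.pi_gt_three]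
    set E := ∑ i ∈ Finset.range p, ∑ j ∈ Finset.range p,
      (incrCov θ n (Nat.dist i j) y y ^ 2
        - (κ / Real.sqrt (mesh n) * lagLim (Nat.dist i j)) ^ 2) with hE
    have hsum : ∑ i ∈ Finset.range p, ∑ j ∈ Finset.range p, incrCov θ n (Nat.dist i j) y y ^ 2
        = (κ / Real.sqrt (mesh n)) ^ 2 * (p * (Real.pi / 2 * gammaConst) - t) + E := by
      rw [hE, ht, ← double_sum_lagLim, Finset.mul_sum, ← Finset.sum_add_distrib]
      refine Finset.sum_congr rfl fun i _ => ?_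
      rw [Finset.mul_sum, ← Finset.sum_add_distrib]
      refine Finset.sum_congr rfl fun j _ => ?_
      ring
    have hEb : |E| ≤ 2 * p * (((B + 4) * δ⁻¹ * (2 * A + 2 * κ)) * (1 / Real.sqrt (mesh n))) := by
      have h1 : |E| ≤ ∑ i ∈ Finset.range p, ∑ j ∈ Finset.range p,
          |incrCov θ n (Nat.dist i j) y y ^ 2
            - (κ / Real.sqrt (mesh n) * lagLim (Nat.dist i j)) ^ 2| :=
        (Finset.abs_sum_le_sum_abs _ _).trans
          (Finset.sum_le_sum fun i _ => Finset.abs_sum_le_sum_abs _ _)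
      have h2 := double_sum_le (F := fun r => |incrCov θ n r y y ^ 2
        - (κ / Real.sqrt (mesh n) * lagLim r) ^ 2|) (fun _ => abs_nonneg _) (le_refl p)
      refine h1.trans (h2.trans (mul_le_mul_of_nonneg_left ?_ (by positivity)))
      exact sum_abs_incrCov_sq_sub_le hθ hpos hn (hAsum n hn) hB hκ0 (hBdiff n hn) hδ hy p
    -- The leading part is 2κ²p⁻²(pπΓ/2 - t) with κ² = 1/(πθ₂), so factoring out Γ/(pθ₂) leaves 1 +
    -- r₁. The bounds t ≤ 1/2 and πΓ/2 ≥ 1 give |r₁| ≤ 1/p.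
    refine ⟨-t / (p * (Real.pi / 2 * gammaConst)), 2 * mesh n / (p : ℝ) ^ 2 * E, ?_, ?_, ?_⟩
    · rw [abs_div, abs_neg, abs_of_nonneg ht0, abs_of_pos (by positivity),
        div_le_iff₀ (by positivity), inv_mul_cancel_left₀ hp'.ne']
      linarith
    · rw [abs_mul, abs_of_nonneg hpre0]
      refine (mul_le_mul_of_nonneg_left hEb hpre0).trans ?_
      rw [hpre]
      simp only [ne_eq, not_true_eq_false, if_false, zero_add]
      have h0 : 0 ≤ Real.sqrt (mesh n) / p * δ⁻¹ := by positivity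
      have : 0 ≤ 32 * A * (Real.sqrt (mesh n) / p * δ⁻¹) := by positivity
      linarith
    · have hΓ0 : gammaConst ≠ 0 := by linarith
      rw [if_pos rfl, hsum, mul_add, div_pow, hκ2, Real.sq_sqrt hm.le]
      congr 1
      field_simp
      ring
  · refine ⟨0, 2 * mesh n / (p : ℝ) ^ 2 * ∑ i ∈ Finset.range p, ∑ j ∈ Finset.range p,
      incrCov θ n (Nat.dist i j) y z ^ 2, by simp [hp'.le], ?_, by simp [hyz]⟩
    have hD : ∀ r, |incrCov θ n r y z| ≤ 4 * (|y - z|⁻¹ + δ⁻¹) := fun r => by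
      rw [incrCov_eq hθ hpos hn]
      refine (abs_sub _ _).trans ?_
      linarith [abs_cosLag_add_le hθ hpos hn r hδ hy hz,
        abs_cosLag_sub_le hθ hpos hn r hδ hy hz hyz]
    have h1 := double_sum_le (F := fun r => incrCov θ n r y z ^ 2) (fun _ => sq_nonneg _)
      (le_refl p)
    have h2 := sum_incrCov_sq_le hθ hpos hn (hAsum n hn) hD p
    have h3 : ∑ i ∈ Finset.range p, ∑ j ∈ Finset.range p, incrCov θ n (Nat.dist i j) y z ^ 2
        ≤ 2 * p * ((8 * A * (|y - z|⁻¹ + δ⁻¹)) * (1 / Real.sqrt (mesh n))) := by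
      refine h1.trans (mul_le_mul_of_nonneg_left (h2.trans (le_of_eq ?_)) (by positivity))
      ring
    rw [abs_of_nonneg (mul_nonneg hpre0
      (Finset.sum_nonneg fun i _ => Finset.sum_nonneg fun j _ => sq_nonneg _))]
    refine (mul_le_mul_of_nonneg_left h3 hpre0).trans ?_
    rw [hpre, if_pos hyz]
    have h0 : 0 ≤ Real.sqrt (mesh n) / p * (|y - z|⁻¹ + δ⁻¹) := by positivity
    have : 0 ≤ 4 * (B + 4) * (2 * A + 2 * κ) * (Real.sqrt (mesh n) / p * (|y - z|⁻¹ + δ⁻¹)) := by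
      positivity
    linarith

end

end SPDE

end

/-! ### Assembly of the theorem -/

theorem mainTheorem8 (θ : Fin 3 → ℝ) (hθ : 0 < θ 2) (hpos : 0 < SPDE.eigenvalue θ 1) (σ : ℝ) :
    -- the constant `Γ`: the series converges, `Γ > 0` and `Γ ≈ 0.75`
    Summable (fun r : ℕ => SPDE.I r ^ 2) ∧ 0 < SPDE.gammaConst ∧
    |SPDE.gammaConst - 0.75| < 0.005 ∧
    -- the realized volatilities are square integrable
    (∀ (Ω : Type u) [MeasurableSpace Ω] (P : Measure Ω) [IsProbabilityMeasure P]
      (W : ℕ → ℝ≥0 → Ω → ℝ) (X : ℝ → ℝ → Ω → ℝ), SPDE.IsStationarySolution P θ σ W X →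
      ∀ n p : ℕ, 1 ≤ p → p ≤ n → ∀ y ∈ Ioo (0 : ℝ) 1,
        MemLp (SPDE.realizedVol θ X p n y) 2 P) ∧
    -- the covariance expansion
    (∀ η ∈ Ioo (0 : ℝ) 1, ∃ C : ℝ, 0 < C ∧ ∃ n₀ : ℕ,
      ∀ (Ω : Type u) [MeasurableSpace Ω] (P : Measure Ω) [IsProbabilityMeasure P]
      (W : ℕ → ℝ≥0 → Ω → ℝ) (X : ℝ → ℝ → Ω → ℝ), SPDE.IsStationarySolution P θ σ W X →
      ∀ n ≥ n₀, ∀ p : ℕ, 1 ≤ p → p ≤ n →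
      ∀ δ : ℝ, 0 < δ → ∀ y₁ ∈ Icc δ (1 - δ), ∀ y₂ ∈ Icc δ (1 - δ),
      ∃ r₁ r₂ : ℝ,
        |r₁| ≤ C * min 1 ((p : ℝ)⁻¹ * SPDE.mesh n ^ (η - 1)) ∧
        |r₂| ≤ C * (SPDE.mesh n ^ (1 / 2 : ℝ) / p *
          ((if y₁ ≠ y₂ then |y₁ - y₂|⁻¹ else 0) + δ⁻¹)) ∧
        cov[SPDE.realizedVol θ X p n y₁, SPDE.realizedVol θ X p n y₂; P] =
          (if y₁ = y₂ then (p : ℝ)⁻¹ * SPDE.gammaConst * σ ^ 4 * (θ 2)⁻¹ * (1 + r₁) else 0)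
            + r₂) ∧
    -- the variance over all `n` increments
    (∀ δ : ℝ, 0 < δ → ∃ C : ℝ, 0 < C ∧ ∃ n₀ : ℕ,
      ∀ (Ω : Type u) [MeasurableSpace Ω] (P : Measure Ω) [IsProbabilityMeasure P]
      (W : ℕ → ℝ≥0 → Ω → ℝ) (X : ℝ → ℝ → Ω → ℝ), SPDE.IsStationarySolution P θ σ W X →
      ∀ n ≥ n₀, ∀ y ∈ Icc δ (1 - δ),
      ∃ r : ℝ, |r| ≤ C * Real.sqrt (SPDE.mesh n) ∧
        Var[SPDE.realizedVol θ X n n y; P] =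
          (n : ℝ)⁻¹ * SPDE.gammaConst * σ ^ 4 * (θ 2)⁻¹ * (1 + r)) := by
  obtain ⟨hΓl, hΓu⟩ := SPDE.gammaConst_bounds
  have hΓ : 0 < SPDE.gammaConst := by linarith
  obtain ⟨K, hK, hexp⟩ := SPDE.exists_double_sum_expansion hθ hpos
  have hmem : ∀ {δ y : ℝ}, 0 < δ → y ∈ Icc δ (1 - δ) → y ∈ Ioo (0 : ℝ) 1 := fun hδ hy =>
    ⟨by linarith [hy.1], by linarith [hy.2]⟩
  refine ⟨SPDE.summable_I_sq, hΓ, ?_, ?_, ?_, ?_⟩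
  · rw [abs_lt]
    constructor <;> linarith
  · intro Ω _ P _ W X hX n p _ hpn y hy
    exact SPDE.memLp_realizedVol hθ hpos hX hpn hy
  · intro η hη
    -- The summand 1 keeps the constant at least 1, as the bound on r₁ requires, also when σ = 0.
    refine ⟨K * σ ^ 4 + 1, by positivity, 1, ?_⟩
    intro Ω _ P _ W X hX n hn p hp hpn δ hδ y hy z hz
    obtain ⟨r₁, r₂, h1, h2, h3⟩ := hexp n p hp hpn δ hδ y hy z hz
    have hp' : (1 : ℝ) ≤ p := by exact_mod_cast hp
    have hσ : 0 ≤ K * σ ^ 4 := by positivity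
    refine ⟨r₁, σ ^ 4 * r₂, ?_, ?_, ?_⟩
    · have hmesh : 1 ≤ SPDE.mesh n ^ (η - 1) :=
        Real.one_le_rpow_of_pos_of_le_one_of_nonpos (SPDE.mesh_pos hn) (SPDE.mesh_le_one hn)
          (by linarith [hη.2])
      -- The error 1/p is stronger than the one claimed, because Δ^(η-1) ≥ 1 for Δ ≤ 1 and η < 1.
      have hle : (p : ℝ)⁻¹ ≤ min 1 ((p : ℝ)⁻¹ * SPDE.mesh n ^ (η - 1)) :=
        le_min (inv_le_one_of_one_le₀ hp') (le_mul_of_one_le_right (by positivity) hmesh)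
      have h0 : 0 ≤ (p : ℝ)⁻¹ := by positivity
      refine h1.trans (hle.trans (le_mul_of_one_le_left (h0.trans hle) (by linarith)))
    · rw [← Real.sqrt_eq_rpow, abs_mul, abs_of_nonneg (by positivity : (0 : ℝ) ≤ σ ^ 4)]
      have h0 : 0 ≤ Real.sqrt (SPDE.mesh n) / p *
          ((if y ≠ z then |y - z|⁻¹ else 0) + δ⁻¹) := by
        split_ifs <;> positivity
      calc σ ^ 4 * |r₂| ≤ σ ^ 4 * (K * (Real.sqrt (SPDE.mesh n) / p *
            ((if y ≠ z then |y - z|⁻¹ else 0) + δ⁻¹))) :=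
            mul_le_mul_of_nonneg_left h2 (by positivity)
        _ = (K * σ ^ 4) * (Real.sqrt (SPDE.mesh n) / p *
            ((if y ≠ z then |y - z|⁻¹ else 0) + δ⁻¹)) := by ring
        _ ≤ _ := mul_le_mul_of_nonneg_right (by linarith) h0
    · rw [SPDE.covariance_realizedVol hθ hpos hX hp hpn (hmem hδ hy) (hmem hδ hz)]
      rw [show 2 * σ ^ 4 * SPDE.mesh n / (p : ℝ) ^ 2 = σ ^ 4 * (2 * SPDE.mesh n / (p : ℝ) ^ 2) by
        ring, mul_assoc, h3]
      split_ifs <;> ring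
  · intro δ hδ
    refine ⟨1 + K * δ⁻¹ * (θ 2 / SPDE.gammaConst), by positivity, 1, ?_⟩
    intro Ω _ P _ W X hX n hn y hy
    obtain ⟨r₁, r₂, h1, h2, h3⟩ := hexp n n hn le_rfl δ hδ y hy y hy
    have hn' : (0 : ℝ) < n := by exact_mod_cast hn
    have hm0 := SPDE.mesh_pos hn
    simp only [ne_eq, not_true_eq_false, if_false, zero_add, if_true] at h2 h3
    -- The additive remainder is turned into a relative one by dividing by Γ/(nθ₂). The factor σ⁴ is
    -- still outside at this point, so σ = 0 causes no trouble.
    refine ⟨r₁ + r₂ * n * (θ 2 / SPDE.gammaConst), ?_, ?_⟩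
    · have hm : (n : ℝ)⁻¹ ≤ Real.sqrt (SPDE.mesh n) := by
        refine Real.le_sqrt_of_sq_le ?_
        have h4 : SPDE.mesh n = (n : ℝ)⁻¹ := one_div _
        rw [← h4, sq]
        exact mul_le_of_le_one_left hm0.le (SPDE.mesh_le_one hn)
      refine (abs_add_le _ _).trans ?_
      rw [abs_mul, abs_mul, abs_of_pos hn', abs_of_pos (by positivity : 0 < θ 2 / SPDE.gammaConst)]
      calc |r₁| + |r₂| * n * (θ 2 / SPDE.gammaConst)
          ≤ Real.sqrt (SPDE.mesh n) + K * (Real.sqrt (SPDE.mesh n) / n * δ⁻¹) * n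
            * (θ 2 / SPDE.gammaConst) := by
            have := h1.trans hm
            gcongr
        _ = _ := by
            field_simp
    · have hv := SPDE.covariance_realizedVol hθ hpos hX hn le_rfl (hmem hδ hy) (hmem hδ hy)
      rw [covariance_self (SPDE.memLp_realizedVol hθ hpos hX le_rfl
        (hmem hδ hy)).aestronglyMeasurable.aemeasurable] at hv
      rw [hv, show 2 * σ ^ 4 * SPDE.mesh n / (n : ℝ) ^ 2
        = σ ^ 4 * (2 * SPDE.mesh n / (n : ℝ) ^ 2) by ring, mul_assoc, h3]
      field_simp
      ring
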